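/- Let $\mathbb X$ be a Polish space with its Borel $\sigma$-algebra and let $(X_n)_{n\ge1}$ be an exchangeable sequence of $\mathbb X$-valued random variables on a probability space $(\Omega,\mathcal F,\mathbb P)$, i.e. $(X_{\sigma(1)},\dots,X_{\sigma(n)})$ and $(X_1,\dots,X_n)$ have the same law for every $n$ and every permutation $\sigma$ of $\{1,\dots,n\}$. Let $X_1\sim P_0$, and write $\hat F_n=\frac1n\sum_{i=1}^n\delta_{X_i}$. Assume Johnson's sufficientness postulate: for every $n\ge1$ and every measurable $A\subseteq\mathbb X$, $$\mathbb P(X_{n+1}\in A\mid X_1,\dots,X_n)=\mathbb P(X_{n+1}\in A\mid \hat F_n(A))\quad\text{a.s.}$$ Assume moreover that * $P_0$ is not concentrated on two points, i.e. $P_0(\{a,b\})<1$ for all $a,b\in\mathbb X$; * it is not the case that $X_1=X_2$ almost surely; * the $X_i$ are not independent. A random probability measure $\tilde F$ on $\mathbb X$, defined on $\Omega$, is called a directing random measure of $(X_n)_{n\ge1}$ if, conditionally on $\tilde F$, the $X_i$ are i.i.d. with law $\tilde F$: for all $n$ and all measurable $A_1,\dots,A_n$, $\mathbb P(X_1\in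 A_1,\dots,X_n\in A_n\mid\tilde F)=\prod_{i=1}^n\tilde F(A_i)$ a.s. Then a directing random measure exists, and there is an $\alpha>0$ such that every directing random measure $\tilde F$ of $(X_n)_{n\ge1}$ is a Dirichlet process $\mathrm{DP}(\alpha,P_0)$; that is, for every finite measurable partition $A_1,\dots,A_k$ of $\mathbb X$, $$(\tilde F(A_1),\dots,\tilde F(A_k))\sim\mathrm{Dirichlet}(\alpha P_0(A_1),\dots,\alpha P_0(A_k)),$$ where the Dirichlet distribution with parameters $a_1,\dots,a_k\ge0$, not all zero, is the law of $(Z_i/\sum_jZ_j)_{i\le k}$ with $Z_1,\dots,Z_k$ independent, $Z_i\sim\mathrm{Gamma}(a_i,1)$ if $a_i>0$ and $Z_i=0$ if $a_i=0$. -/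

import Mathlib

open MeasureTheory ProbabilityTheory
open scoped ENNReal

noncomputable section

/-- The empirical distribution `(1/n) ∑_{i < n} δ_{X i}` of the first `n` observations
`X 0, …, X (n - 1)` (meaningful for `n ≥ 1`). -/
def empiricalDist {Ω 𝕏 : Type*} [MeasurableSpace 𝕏] (X : ℕ → Ω → 𝕏) (n : ℕ) (ω : Ω) :
    Measure 𝕏 :=
  (n : ℝ≥0∞)⁻¹ • ∑ i ∈ Finset.range n, Measure.dirac (X i ω)

/-- The law of the sequence is invariant under permutations of finitely many indices. -/
def Exchangeable {Ω 𝕏 : Type*} [MeasurableSpace Ω] [MeasurableSpace 𝕏]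
    (X : ℕ → Ω → 𝕏) (μ : Measure Ω) : Prop :=
  ∀ (n : ℕ) (σ : Equiv.Perm (Fin n)),
    μ.map (fun ω (i : Fin n) => X (σ i) ω) = μ.map (fun ω (i : Fin n) => X i ω)

/-- The sigma-algebra generated by the first `n` observations `X 0, …, X (n - 1)`. -/
abbrev pastSigma {Ω 𝕏 : Type*} [MeasurableSpace 𝕏] (X : ℕ → Ω → 𝕏) (n : ℕ) : MeasurableSpace Ω :=
  MeasurableSpace.comap (fun ω (i : Fin n) => X i ω) MeasurableSpace.pi

/-- The sigma-algebra generated by the empirical frequency of `A` among the first `n`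
observations. -/
abbrev freqSigma {Ω 𝕏 : Type*} [MeasurableSpace 𝕏] (X : ℕ → Ω → 𝕏) (n : ℕ) (A : Set 𝕏) :
    MeasurableSpace Ω :=
  MeasurableSpace.comap (fun ω => (empiricalDist X n ω).real A) inferInstance

/-- Johnson's sufficientness postulate: for every `n ≥ 1` and every measurable `A`, the conditional
probability that the next observation falls in `A`, given the first `n` observations, equals its
conditional probability given only the empirical frequency of `A` among them. -/
def Sufficientness {Ω 𝕏 : Type*} [MeasurableSpace Ω] [MeasurableSpace 𝕏]
    (X : ℕ → Ω → 𝕏) (μ : Measure Ω) : Prop :=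
  ∀ n : ℕ, 1 ≤ n → ∀ A : Set 𝕏, MeasurableSet A →
    μ[(X n ⁻¹' A).indicator (fun _ => (1 : ℝ)) | pastSigma X n]
      =ᵐ[μ] μ[(X n ⁻¹' A).indicator (fun _ => (1 : ℝ)) | freqSigma X n A]

/-- `F` is the directing random measure of the sequence `X`: conditionally on `F`, the variables
`X 0, X 1, …` are independent with common distribution `F`. -/
structure IsDirectingMeasure {Ω 𝕏 : Type*} [MeasurableSpace Ω] [MeasurableSpace 𝕏]
    (F : Ω → ProbabilityMeasure 𝕏) (X : ℕ → Ω → 𝕏) (μ : Measure Ω) : Prop where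
  measurable : Measurable F
  condIID : ∀ (n : ℕ) (A : Fin n → Set 𝕏), (∀ i, MeasurableSet (A i)) →
    μ[(⋂ i : Fin n, X i ⁻¹' A i).indicator (fun _ => (1 : ℝ)) |
        MeasurableSpace.comap F inferInstance]
      =ᵐ[μ] fun ω => ∏ i : Fin n, (F ω : Measure 𝕏).real (A i)

/-- The gamma distribution with shape `a ≥ 0` and rate `1`, degenerate at `0` when `a = 0`. -/
def gammaShape (a : ℝ) : Measure ℝ :=
  if a = 0 then Measure.dirac 0 else gammaMeasure a 1

/-- The Dirichlet distribution with nonnegative parameters `a i`, not all zero: the law of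
`(Z i / ∑ j, Z j)` where the `Z i` are independent gamma variables with shapes `a i`.
Coordinates with parameter zero vanish almost surely. -/
def dirichletDist {ι : Type*} [Fintype ι] (a : ι → ℝ) : Measure (ι → ℝ) :=
  (Measure.pi fun i => gammaShape (a i)).map fun z i => z i / ∑ j, z j

/-- `π` is the law `DP(α, P₀)` of a Dirichlet process: if `P ∼ π`, then for every finite measurable
partition `A 0, …, A (k - 1)` of the space, `(P (A 0), …, P (A (k - 1)))` has the Dirichlet
distribution with parameters `α P₀(A 0), …, α P₀(A (k - 1))`. -/
def IsDirichletProcessLaw {𝕏 : Type*} [MeasurableSpace 𝕏] (α : ℝ) (P₀ : Measure 𝕏)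
    (π : Measure (ProbabilityMeasure 𝕏)) : Prop :=
  ∀ (k : ℕ) (A : Fin k → Set 𝕏), (∀ i, MeasurableSet (A i)) →
    Pairwise (fun i j => Disjoint (A i) (A j)) → (⋃ i, A i) = Set.univ →
    π.map (fun (P : ProbabilityMeasure 𝕏) i => (P : Measure 𝕏).real (A i)) = dirichletDist fun i => α * P₀.real (A i)

end

/-! ### Gamma distributions and Dirichlet moments -/

/-! Let q be the law of one observation. For one past observation the postulate gives P(X₀ ∈ B, X₁ ∈
A) = r(A) q(B) for every B disjoint from A. Exchangeability makes the left side symmetric, so r is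
proportional to q on nontrivial events, and all of them share one correlation t
(`exists_correlation`). Exchangeable events are nonnegatively correlated, so t ≥ 0; t ≥ 1 would
force X₀ = X₁ almost surely, and t = 0 would force independence. Hence 0 < t < 1.

For a longer past, take a partition into three cells of positive mass. The predictive probability of
each cell is a function of its own count, and the three values sum to one at every count vector;
moving one observation between cells shows that such functions are affine
(`exists_linear_predictive`). Exchangeability and t fix the two coefficients, which gives the rule
`IsPredictive` by induction on the sample size (`isPredictive_of_sufficientness`). Since the law
does not live on two points, any event or its complement can be split in two, so every nontrivial
event is a cell of such a partition or the complement of one.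

Multiplied along a word, the rule gives Pólya urn probabilities with total mass α = (1 - t)/t
(`real_wordEvent_eq_urnWeight`). These are the mixed moments of any directing measure on a
partition, and also those of the Dirichlet law (`lintegral_list_prod_dirichletDist`); moments
determine laws on the cube (`measure_ext_of_moments`). Existence is de Finetti's theorem: the
conditional law of the first observation given all later ones directs the sequence
(`Exchangeable.exists_isDirectingMeasure`). -/

theorem gammaShape_of_pos {a : ℝ} (ha : 0 < a) : gammaShape a = gammaMeasure a 1 := by
  simp [gammaShape, ha.ne']

theorem gammaShape_zero : gammaShape 0 = Measure.dirac 0 := by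
  simp [gammaShape]

theorem isProbabilityMeasure_gammaShape {a : ℝ} (ha : 0 ≤ a) :
    IsProbabilityMeasure (gammaShape a) := by
  rcases ha.eq_or_lt with rfl | ha
  · rw [gammaShape_zero]; infer_instance
  · rw [gammaShape_of_pos ha]; exact isProbabilityMeasure_gammaMeasure ha one_pos

theorem measurable_gammaPDF (a r : ℝ) : Measurable (gammaPDF a r) :=
  (measurable_gammaPDFReal a r).ennreal_ofReal

theorem gammaPDF_mul_self {a : ℝ} (ha : 0 < a) (x : ℝ) :
    gammaPDF a 1 x * ENNReal.ofReal x = ENNReal.ofReal a * gammaPDF (a + 1) 1 x := by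
  rcases lt_or_ge x 0 with hx | hx
  · simp [gammaPDF_of_neg hx]
  · rw [gammaPDF_of_nonneg hx, gammaPDF_of_nonneg hx, ← ENNReal.ofReal_mul' hx,
      ← ENNReal.ofReal_mul ha.le]
    congr 1
    rw [Real.Gamma_add_one ha.ne', add_sub_cancel_right]
    have hG := (Real.Gamma_pos_of_pos ha).ne'
    rcases hx.eq_or_lt with rfl | hx
    · simp [Real.zero_rpow ha.ne']
    · have : x ^ a = x ^ (a - 1) * x := by
        rw [← Real.rpow_add_one hx.ne']; ring_nf
      rw [this]
      simp only [Real.one_rpow]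
      field_simp

/-- Size-biasing a gamma law raises its shape by one, because Γ(a + 1) = a Γ(a). At a = 0 both sides
vanish, so cells of mass zero need no separate treatment later. -/
theorem gammaShape_withDensity_ofReal {a : ℝ} (ha : 0 ≤ a) :
    (gammaShape a).withDensity ENNReal.ofReal = ENNReal.ofReal a • gammaShape (a + 1) := by
  rcases ha.eq_or_lt with rfl | ha
  · rw [gammaShape_zero]
    ext s hs
    rw [withDensity_apply _ hs]
    rw [← lintegral_indicator hs, lintegral_dirac' _ (ENNReal.measurable_ofReal.indicator hs)]
    by_cases h : (0 : ℝ) ∈ s <;> simp [h]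
  · rw [gammaShape_of_pos ha, gammaShape_of_pos (by linarith), gammaMeasure, gammaMeasure,
      ← withDensity_mul _ (measurable_gammaPDF _ _) ENNReal.measurable_ofReal,
      ← withDensity_smul _ (measurable_gammaPDF _ _)]
    congr 1
    ext x
    exact gammaPDF_mul_self ha x

theorem gammaPDF_mul_exp {a t : ℝ} (ht : 0 < t) (x : ℝ) :
    gammaPDF a 1 x * ENNReal.ofReal (Real.exp (-(t * x))) =
      ENNReal.ofReal ((1 + t) ^ (-a)) * gammaPDF a (1 + t) x := by
  rcases lt_or_ge x 0 with hx | hx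
  · simp [gammaPDF_of_neg hx]
  · rw [gammaPDF_of_nonneg hx, gammaPDF_of_nonneg hx, ← ENNReal.ofReal_mul' (Real.exp_pos _).le,
      ← ENNReal.ofReal_mul (by positivity)]
    congr 1
    have h1 : (1 + t) ^ (-a) * (1 + t) ^ a = 1 := by
      rw [← Real.rpow_add (by linarith)]; simp
    have h2 : Real.exp (-((1 + t) * x)) = Real.exp (-(1 * x)) * Real.exp (-(t * x)) := by
      rw [← Real.exp_add]; ring_nf
    rw [h2, Real.one_rpow]
    linear_combination (-(1 / Real.Gamma a * x ^ (a - 1) * (Real.exp (-(1 * x)) *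
      Real.exp (-(t * x))))) * h1

/-- Exponential tilting only changes the rate from 1 to 1 + t; the ratio of normalising constants is
the Laplace transform. -/
theorem lintegral_exp_gammaShape {a t : ℝ} (ha : 0 ≤ a) (ht : 0 < t) :
    ∫⁻ x, ENNReal.ofReal (Real.exp (-(t * x))) ∂gammaShape a =
      ENNReal.ofReal ((1 + t) ^ (-a)) := by
  rcases ha.eq_or_lt with rfl | ha
  · rw [gammaShape_zero, lintegral_dirac]; simp
  · have hm : Measurable fun x : ℝ => ENNReal.ofReal (Real.exp (-(t * x))) := by fun_prop
    rw [gammaShape_of_pos ha, gammaMeasure,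
      lintegral_withDensity_eq_lintegral_mul _ (measurable_gammaPDF _ _) hm]
    simp only [Pi.mul_apply, gammaPDF_mul_exp ht]
    rw [lintegral_const_mul _ (measurable_gammaPDF _ _),
      lintegral_gammaPDF_eq_one ha (by linarith), mul_one]

theorem gammaShape_ae_nonneg {a : ℝ} (ha : 0 ≤ a) : ∀ᵐ x ∂gammaShape a, 0 ≤ x := by
  rcases ha.eq_or_lt with rfl | ha
  · rw [gammaShape_zero, ae_dirac_iff measurableSet_Ici]
  · rw [gammaShape_of_pos ha, gammaMeasure, ae_withDensity_iff (measurable_gammaPDF _ _)]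
    refine Filter.Eventually.of_forall fun x hx => ?_
    by_contra h
    exact hx (gammaPDF_of_neg (not_le.1 h))

theorem gammaShape_ae_pos {a : ℝ} (ha : 0 < a) : ∀ᵐ x ∂gammaShape a, 0 < x := by
  have h0 : ∀ᵐ x ∂gammaShape a, x ≠ 0 := by
    rw [gammaShape_of_pos ha, gammaMeasure]
    exact (withDensity_absolutelyContinuous _ _).ae_le (Measure.ae_ne volume 0)
  filter_upwards [gammaShape_ae_nonneg ha.le, h0] with x h1 h2
  exact lt_of_le_of_ne h1 h2.symm

/-- Laplace representation of negative powers. -/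
theorem ofReal_pow_inv_eq_lintegral {s : ℝ} (hs : 0 < s) {n : ℕ} (hn : n ≠ 0) :
    (ENNReal.ofReal s ^ n)⁻¹ = ∫⁻ t in Set.Ioi (0 : ℝ),
      ENNReal.ofReal (t ^ ((n : ℝ) - 1) / Real.Gamma n) * ENNReal.ofReal (Real.exp (-(t * s))) := by
  have hn' : (0 : ℝ) < n := by positivity
  have hG := Real.Gamma_pos_of_pos hn'
  -- The claim is the normalisation of the gamma density of shape n and rate s, divided by s ^ n.
  have h1 := lintegral_gammaPDF_eq_one hn' hs
  have h2 : ∫⁻ x, gammaPDF n s x = ∫⁻ x in Set.Ioi (0 : ℝ), gammaPDF n s x := by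
    rw [← lintegral_add_compl _ measurableSet_Ioi, Set.compl_Ioi,
      setLIntegral_congr (Iio_ae_eq_Iic (a := (0:ℝ))).symm, lintegral_gammaPDF_of_nonpos le_rfl,
      add_zero]
  have hm : Measurable fun t : ℝ => ENNReal.ofReal (t ^ ((n : ℝ) - 1) / Real.Gamma n) *
      ENNReal.ofReal (Real.exp (-(t * s))) := by fun_prop
  have h3 : ∫⁻ x in Set.Ioi (0 : ℝ), gammaPDF n s x = ENNReal.ofReal s ^ n *
      ∫⁻ t in Set.Ioi (0 : ℝ),
      ENNReal.ofReal (t ^ ((n : ℝ) - 1) / Real.Gamma n) *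
        ENNReal.ofReal (Real.exp (-(t * s))) := by
    rw [← lintegral_const_mul _ hm]
    refine setLIntegral_congr_fun measurableSet_Ioi fun x (hx : 0 < x) => ?_
    rw [gammaPDF_of_nonneg hx.le, ← ENNReal.ofReal_pow hs.le, ← ENNReal.ofReal_mul (by positivity),
      ← ENNReal.ofReal_mul (by positivity), Real.rpow_natCast]
    congr 1
    rw [mul_comm s x]
    ring
  rw [h2, h3] at h1
  exact (ENNReal.eq_inv_of_mul_eq_one_left (by rw [mul_comm]; exact h1)).symm

/-! ### Moments of normalised independent gamma variables -/

section Dirichlet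

variable {ι : Type*} [Fintype ι]

theorem lintegral_prod_gammaShape {b : ι → ℝ} (hb : ∀ i, 0 ≤ b i) (f : ι → ℝ → ℝ≥0∞)
    (hf : ∀ i, Measurable (f i)) :
    ∫⁻ z, ∏ i, f i (z i) ∂(Measure.pi fun i => gammaShape (b i)) =
      ∏ i, ∫⁻ x, f i x ∂gammaShape (b i) := by
  have := fun i => isProbabilityMeasure_gammaShape (hb i)
  refine (lintegral_prod_eq_prod_lintegral_of_indepFun Finset.univ
    (fun i (z : ι → ℝ) => f i (z i)) (iIndepFun_pi fun i => (hf i).aemeasurable)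
    fun i => (hf i).comp (measurable_pi_apply i)).trans ?_
  refine Finset.prod_congr rfl fun i _ => ?_
  exact (measurePreserving_eval (fun i => gammaShape (b i)) i).lintegral_comp (hf i)

theorem pi_gammaShape_ae_sum_pos {b : ι → ℝ} (hb : ∀ i, 0 ≤ b i) (hB : 0 < ∑ i, b i) :
    ∀ᵐ z ∂(Measure.pi fun j => gammaShape (b j)), (∀ i, 0 ≤ z i) ∧ 0 < ∑ i, z i := by
  have := fun i => isProbabilityMeasure_gammaShape (hb i)
  obtain ⟨i, -, hi⟩ := Finset.exists_lt_of_sum_lt (s := Finset.univ) (f := fun _ : ι => (0 : ℝ))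
    (g := b) (by simpa using hB)
  have h1 : ∀ᵐ z ∂(Measure.pi fun j => gammaShape (b j)), ∀ j, 0 ≤ z j :=
    ae_all_iff.2 fun j => Measure.tendsto_eval_ae_ae.eventually (gammaShape_ae_nonneg (hb j))
  have h2 : ∀ᵐ z ∂(Measure.pi fun j => gammaShape (b j)), 0 < z i :=
    Measure.tendsto_eval_ae_ae.eventually (gammaShape_ae_pos hi)
  filter_upwards [h1, h2] with z h1 h2
  exact ⟨h1, h2.trans_le (Finset.single_le_sum (fun j _ => h1 j) (Finset.mem_univ i))⟩

/-- The negative moments of the sum of independent gamma variables. -/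
theorem lintegral_sum_pow_inv_pi_gammaShape {b : ι → ℝ} (hb : ∀ i, 0 ≤ b i) (hB : 0 < ∑ i, b i)
    {n : ℕ} (hn : n ≠ 0) :
    ∫⁻ z, (ENNReal.ofReal (∑ i, z i) ^ n)⁻¹ ∂(Measure.pi fun j => gammaShape (b j)) =
      ∫⁻ t in Set.Ioi (0 : ℝ), ENNReal.ofReal (t ^ ((n : ℝ) - 1) / Real.Gamma n) *
        ENNReal.ofReal ((1 + t) ^ (-∑ i, b i)) := by
  have := fun i => isProbabilityMeasure_gammaShape (hb i)
  have h1 : ∫⁻ z, (ENNReal.ofReal (∑ i, z i) ^ n)⁻¹ ∂(Measure.pi fun j => gammaShape (b j)) =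
      ∫⁻ z, (∫⁻ t in Set.Ioi (0 : ℝ),
      ENNReal.ofReal (t ^ ((n : ℝ) - 1) / Real.Gamma n) *
        ENNReal.ofReal (Real.exp (-(t * ∑ i, z i)))) ∂(Measure.pi fun j => gammaShape (b j)) := by
    refine lintegral_congr_ae ?_
    filter_upwards [pi_gammaShape_ae_sum_pos hb hB] with z hz
    exact ofReal_pow_inv_eq_lintegral hz.2 hn
  -- After Tonelli the Laplace transforms multiply to (1 + t) ^ (-∑ b i). The result depends on the
  -- shapes only through their sum, which is the fact used later.
  rw [h1, lintegral_lintegral_swap (by fun_prop)]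
  refine setLIntegral_congr_fun measurableSet_Ioi fun t (ht : 0 < t) => ?_
  rw [lintegral_const_mul _ (by fun_prop)]
  congr 1
  have h2 : ∀ z : ι → ℝ, ENNReal.ofReal (Real.exp (-(t * ∑ i, z i))) =
      ∏ i, ENNReal.ofReal (Real.exp (-(t * z i))) := fun z => by
    rw [← ENNReal.ofReal_prod_of_nonneg fun i _ => (Real.exp_pos _).le, ← Real.exp_sum,
      Finset.mul_sum, Finset.sum_neg_distrib]
  simp_rw [h2]
  rw [lintegral_prod_gammaShape hb (fun _ x => ENNReal.ofReal (Real.exp (-(t * x))))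
    (fun _ => by fun_prop), Finset.prod_congr rfl fun i _ => lintegral_exp_gammaShape (hb i) ht,
    ← ENNReal.ofReal_prod_of_nonneg fun i _ => by positivity]
  congr 1
  rw [← Finset.sum_neg_distrib, Real.rpow_sum_of_pos (by linarith)]

variable [DecidableEq ι]

theorem pi_gammaShape_withDensity {b : ι → ℝ} (hb : ∀ i, 0 ≤ b i) (i : ι) :
    (Measure.pi fun j => gammaShape (b j)).withDensity (fun z => ENNReal.ofReal (z i)) =
      ENNReal.ofReal (b i) • Measure.pi fun j => gammaShape (b j + if j = i then 1 else 0) := by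
  have := fun i => isProbabilityMeasure_gammaShape (hb i)
  have hb' : ∀ j, 0 ≤ b j + if j = i then 1 else 0 := fun j => by
    have := hb j; split_ifs <;> linarith
  have := fun j => isProbabilityMeasure_gammaShape (hb' j)
  -- The scalar `b i` is charged to the factor `i`, so that both sides can be compared with one
  -- product of finite measures.
  let c : ι → ℝ≥0∞ := fun j => if j = i then ENNReal.ofReal (b i) else 1
  have hc : ∀ j, c j ≠ ∞ := fun j => by simp only [c]; split_ifs <;> simp
  let ν : ι → Measure ℝ := fun j => c j • gammaShape (b j + if j = i then 1 else 0)
  have hν : ∀ j, IsFiniteMeasure (ν j) := fun j => Measure.smul_finite _ (hc j)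
  have hprod : ∏ j, c j = ENNReal.ofReal (b i) := by
    simp [c, Finset.prod_ite_eq']
  trans Measure.pi ν
  · symm
    refine Measure.pi_eq fun s hs => ?_
    rw [withDensity_apply _ (MeasurableSet.univ_pi hs), ← lintegral_indicator
      (MeasurableSet.univ_pi hs)]
    let f : ι → ℝ → ℝ≥0∞ := fun j =>
      (s j).indicator fun x => if j = i then ENNReal.ofReal x else 1
    have hf : ∀ j, Measurable (f j) := fun j => by
      refine Measurable.indicator ?_ (hs j)
      by_cases h : j = i <;> simp only [h, if_true, if_false] <;> fun_prop
    have h1 : ∀ z : ι → ℝ, (Set.univ.pi s).indicator (fun z => ENNReal.ofReal (z i)) z =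
        ∏ j, f j (z j) := by
      intro z
      by_cases hz : z ∈ Set.univ.pi s
      · rw [Set.indicator_of_mem hz]
        have : ∀ j, f j (z j) = if j = i then ENNReal.ofReal (z j) else 1 := fun j => by
          simp only [f]; rw [Set.indicator_of_mem (hz j trivial)]
        simp [this, Finset.prod_ite_eq']
      · rw [Set.indicator_of_notMem hz]
        simp only [Set.mem_univ_pi, not_forall] at hz
        obtain ⟨j, hj⟩ := hz
        exact (Finset.prod_eq_zero (Finset.mem_univ j) (Set.indicator_of_notMem hj _)).symm
    simp_rw [h1]
    rw [lintegral_prod_gammaShape hb f hf]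
    refine Finset.prod_congr rfl fun j _ => ?_
    simp only [f]
    rw [lintegral_indicator (hs j)]
    by_cases h : j = i
    · subst h
      have := congrArg (fun m : Measure ℝ => m (s j)) (gammaShape_withDensity_ofReal (hb j))
      simp only [withDensity_apply _ (hs j)] at this
      simpa [ν, c] using this
    · simp [ν, c, h]
  · refine Measure.pi_eq fun s hs => ?_
    simp only [Measure.smul_apply, Measure.pi_pi, smul_eq_mul, ν, Finset.prod_mul_distrib, hprod]

theorem lintegral_mul_pi_gammaShape {b : ι → ℝ} (hb : ∀ i, 0 ≤ b i) (i : ι)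
    {φ : (ι → ℝ) → ℝ≥0∞} (hφ : Measurable φ) :
    ∫⁻ z, ENNReal.ofReal (z i) * φ z ∂(Measure.pi fun j => gammaShape (b j)) =
      ENNReal.ofReal (b i) *
        ∫⁻ z, φ z ∂(Measure.pi fun j => gammaShape (b j + if j = i then 1 else 0)) := by
  rw [← smul_eq_mul, ← lintegral_smul_measure, ← pi_gammaShape_withDensity hb,
    lintegral_withDensity_eq_lintegral_mul _ (by fun_prop) hφ]
  rfl

/-- The Pólya urn weight of a word, whose most recent letter comes first. -/
noncomputable def urnWeight (a : ι → ℝ) : List ι → ℝ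
  | [] => 1
  | i :: l => (a i + l.count i) / (∑ j, a j + l.length) * urnWeight a l

/-- Product of the shape increments along a word. -/
noncomputable def risingWeight {ι : Type*} [DecidableEq ι] (a : ι → ℝ) : List ι → ℝ
  | [] => 1
  | i :: l => (a i + l.count i) * risingWeight a l

theorem risingWeight_nonneg {ι : Type*} [DecidableEq ι] {a : ι → ℝ} (ha : ∀ i, 0 ≤ a i) (l : List ι) :
    0 ≤ risingWeight a l := by
  induction l with
  | nil => simp [risingWeight]
  | cons i l ih => have := ha i; simp only [risingWeight]; positivity

/-- Size-biasing once per letter: each occurrence of a letter raises its shape by one and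
contributes the current shape as a factor. The free function `φ` absorbs the remaining letters in
the induction and later carries the normalising power of the sum. -/
theorem lintegral_list_prod_mul_pi_gammaShape {b : ι → ℝ} (hb : ∀ i, 0 ≤ b i) (l : List ι)
    {φ : (ι → ℝ) → ℝ≥0∞} (hφ : Measurable φ) :
    ∫⁻ z, (l.map fun i => ENNReal.ofReal (z i)).prod * φ z
        ∂(Measure.pi fun j => gammaShape (b j)) =
      ENNReal.ofReal (risingWeight b l) *
        ∫⁻ z, φ z ∂(Measure.pi fun j => gammaShape (b j + l.count j)) := by
  induction l generalizing φ with
  | nil => simp [risingWeight]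
  | cons i l ih =>
    have h1 : ∀ z : ι → ℝ, ((i :: l).map fun i => ENNReal.ofReal (z i)).prod * φ z =
        (l.map fun i => ENNReal.ofReal (z i)).prod * (ENNReal.ofReal (z i) * φ z) := fun z => by
      simp only [List.map_cons, List.prod_cons]; ring
    simp_rw [h1]
    rw [ih (by fun_prop), lintegral_mul_pi_gammaShape (fun j => add_nonneg (hb j) (by positivity))
      i hφ, ← mul_assoc, ← ENNReal.ofReal_mul (risingWeight_nonneg hb l)]
    congr 1
    · simp only [risingWeight]; congr 1; ring
    · congr 2
      ext j
      congr 1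
      rw [List.count_cons]
      by_cases h : j = i
      · simp [h, add_assoc]
      · simp [h, Ne.symm h]

/-- With S the sum of the coordinates, write S⁻ⁿ = ∑ zᵢ S⁻⁽ⁿ⁺¹⁾ and size-bias each term. All the
resulting integrals agree, since they depend only on the total shape. This produces the denominators
of the urn weights without evaluating any negative moment. -/
theorem lintegral_sum_pow_inv_succ {b b' : ι → ℝ} (hb : ∀ i, 0 ≤ b i) (hB : 0 < ∑ i, b i)
    (hb' : ∀ i, 0 ≤ b' i) (hbb' : ∑ i, b' i = ∑ i, b i + 1) (n : ℕ) :
    ∫⁻ z, (ENNReal.ofReal (∑ i, z i) ^ n)⁻¹ ∂(Measure.pi fun j => gammaShape (b j)) =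
      ENNReal.ofReal (∑ i, b i) *
        ∫⁻ z, (ENNReal.ofReal (∑ i, z i) ^ (n + 1))⁻¹
          ∂(Measure.pi fun j => gammaShape (b' j)) := by
  have h1 : ∫⁻ z, (ENNReal.ofReal (∑ i, z i) ^ n)⁻¹ ∂(Measure.pi fun j => gammaShape (b j)) =
      ∫⁻ z, ∑ i, ENNReal.ofReal (z i) * (ENNReal.ofReal (∑ i, z i) ^ (n + 1))⁻¹
        ∂(Measure.pi fun j => gammaShape (b j)) := by
    refine lintegral_congr_ae ?_
    filter_upwards [pi_gammaShape_ae_sum_pos hb hB] with z hz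
    have hS : ENNReal.ofReal (∑ i, z i) ≠ 0 := by simpa using hz.2
    rw [← Finset.sum_mul, ← ENNReal.ofReal_sum_of_nonneg fun i _ => hz.1 i, pow_succ,
      ENNReal.mul_inv (Or.inr ENNReal.ofReal_ne_top) (Or.inr hS), mul_comm, mul_assoc,
      ENNReal.inv_mul_cancel hS ENNReal.ofReal_ne_top, mul_one]
  rw [h1, lintegral_finsetSum _ fun i _ => by fun_prop,
    ENNReal.ofReal_sum_of_nonneg fun i _ => hb i, Finset.sum_mul]
  refine Finset.sum_congr rfl fun i _ => ?_
  have hbi : ∀ j, 0 ≤ b j + if j = i then 1 else 0 := fun j => by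
    have := hb j; split_ifs <;> linarith
  have hsum : ∑ j, (b j + if j = i then 1 else 0) = ∑ i, b i + 1 := by
    simp [Finset.sum_add_distrib]
  rw [lintegral_mul_pi_gammaShape hb i (by fun_prop),
    lintegral_sum_pow_inv_pi_gammaShape hbi (by rw [hsum]; linarith) n.succ_ne_zero,
    lintegral_sum_pow_inv_pi_gammaShape hb' (by rw [hbb']; linarith) n.succ_ne_zero, hsum, hbb']

theorem sum_add_count (a : ι → ℝ) (l : List ι) :
    ∑ i, (a i + l.count i) = ∑ i, a i + l.length := by
  rw [Finset.sum_add_distrib]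
  congr 1
  have := Multiset.sum_count_eq_card (s := Finset.univ) (m := (l : Multiset ι)) (by simp)
  simp only [Multiset.coe_count, Multiset.coe_card] at this
  exact_mod_cast this

theorem risingWeight_mul_lintegral {a : ι → ℝ} (ha : ∀ i, 0 ≤ a i) (hA : 0 < ∑ i, a i)
    (l : List ι) :
    ENNReal.ofReal (risingWeight a l) * ∫⁻ z, (ENNReal.ofReal (∑ i, z i) ^ l.length)⁻¹
        ∂(Measure.pi fun j => gammaShape (a j + l.count j)) =
      ENNReal.ofReal (urnWeight a l) := by
  induction l with
  | nil =>
    have := fun i => isProbabilityMeasure_gammaShape (ha i)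
    simp [risingWeight, urnWeight]
  | cons i l ih =>
    have hl : ∀ (l : List ι) j, 0 ≤ a j + l.count j := fun l j => add_nonneg (ha j) (by positivity)
    have hpos : 0 < ∑ j, a j + (l.length : ℝ) := by positivity
    rw [lintegral_sum_pow_inv_succ (hl l) (by rw [sum_add_count]; exact hpos) (hl (i :: l))
      (by rw [sum_add_count, sum_add_count]; simp [add_assoc]), sum_add_count] at ih
    simp only [urnWeight, risingWeight, List.length_cons] at ih ⊢
    rw [div_mul_eq_mul_div, mul_div_assoc, ENNReal.ofReal_mul (hl l i), ENNReal.ofReal_mul (hl l i),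
      ENNReal.ofReal_div_of_pos hpos, ← ih, mul_assoc]
    congr 1
    rw [mul_comm (ENNReal.ofReal (∑ j, a j + (l.length : ℝ))), ← mul_assoc]
    exact (ENNReal.mul_div_cancel_right (by simpa using hpos) ENNReal.ofReal_ne_top).symm

omit [Fintype ι] [DecidableEq ι] in
theorem measurable_list_prod_ofReal (l : List ι) :
    Measurable fun x : ι → ℝ => (l.map fun i => ENNReal.ofReal (x i)).prod := by
  induction l with
  | nil => simp
  | cons i l ih =>
    simp only [List.map_cons, List.prod_cons]
    fun_prop

omit [DecidableEq ι] in
theorem measurable_normalize : Measurable fun (z : ι → ℝ) i => z i / ∑ j, z j := by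
  fun_prop

theorem lintegral_list_prod_dirichletDist {a : ι → ℝ} (ha : ∀ i, 0 ≤ a i) (hA : 0 < ∑ i, a i)
    (l : List ι) :
    ∫⁻ x, (l.map fun i => ENNReal.ofReal (x i)).prod ∂dirichletDist a =
      ENNReal.ofReal (urnWeight a l) := by
  rw [dirichletDist, lintegral_map (measurable_list_prod_ofReal l) measurable_normalize,
    ← risingWeight_mul_lintegral ha hA, ← lintegral_list_prod_mul_pi_gammaShape ha l (by fun_prop)]
  refine lintegral_congr_ae ?_
  filter_upwards [pi_gammaShape_ae_sum_pos ha hA] with z hz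
  have hS : ENNReal.ofReal (∑ i, z i) ≠ 0 := by simpa using hz.2
  induction l with
  | nil => simp
  | cons i l ih =>
    simp only [List.map_cons, List.prod_cons, List.length_cons] at ih ⊢
    rw [ih, ENNReal.ofReal_div_of_pos hz.2, pow_succ,
      ENNReal.mul_inv (Or.inr ENNReal.ofReal_ne_top) (Or.inr hS), div_eq_mul_inv]
    ring

omit [DecidableEq ι] in
theorem isProbabilityMeasure_dirichletDist {a : ι → ℝ} (ha : ∀ i, 0 ≤ a i) :
    IsProbabilityMeasure (dirichletDist a) := by
  have := fun i => isProbabilityMeasure_gammaShape (ha i)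
  exact Measure.isProbabilityMeasure_map measurable_normalize.aemeasurable

omit [DecidableEq ι] in
theorem dirichletDist_ae_mem_Icc {a : ι → ℝ} (ha : ∀ i, 0 ≤ a i) (hA : 0 < ∑ i, a i) :
    ∀ᵐ x ∂dirichletDist a, ∀ i, x i ∈ Set.Icc (0 : ℝ) 1 := by
  rw [dirichletDist, ae_map_iff measurable_normalize.aemeasurable (by measurability)]
  filter_upwards [pi_gammaShape_ae_sum_pos ha hA] with z hz i
  exact ⟨div_nonneg (hz.1 i) hz.2.le,
    (div_le_one hz.2).2 (Finset.single_le_sum (fun j _ => hz.1 j) (Finset.mem_univ i))⟩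

end Dirichlet

/-! ### Measures on the cube are determined by their moments -/

section Moments

variable {ι : Type*} [Fintype ι]

/-- The polynomial functions on the cube. -/
noncomputable def cubePolynomials (ι : Type*) [Fintype ι] :
    StarSubalgebra ℝ (BoundedContinuousFunction (ι → unitInterval) ℝ) where
  toSubalgebra := Algebra.adjoin ℝ (Set.range fun i =>
    BoundedContinuousFunction.mkOfCompact
      ⟨fun x : ι → unitInterval => (x i : ℝ), by fun_prop⟩)
  star_mem' := fun {f} h => by
    rwa [show star f = f from BoundedContinuousFunction.ext fun x => star_trivial _]

theorem cubePolynomials_separatesPoints :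
    ((cubePolynomials ι).map
      (BoundedContinuousFunction.toContinuousMapStarₐ ℝ)).SeparatesPoints := by
  intro x y hxy
  obtain ⟨i, hi⟩ := Function.ne_iff.1 hxy
  refine ⟨fun x => (x i : ℝ), ⟨⟨fun x => (x i : ℝ), by fun_prop⟩,
    ⟨_, Algebra.subset_adjoin ⟨i, rfl⟩, rfl⟩, rfl⟩, fun h => hi (Subtype.ext h)⟩

/-- Words index the monomials; these span the polynomials, a subalgebra that separates points of the
cube and hence determines the measure. -/
theorem cube_measure_ext {P Q : Measure (ι → unitInterval)} [IsProbabilityMeasure P]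
    [IsProbabilityMeasure Q]
    (h : ∀ l : List ι, ∫ x, (l.map fun i => (x i : ℝ)).prod ∂P =
      ∫ x, (l.map fun i => (x i : ℝ)).prod ∂Q) : P = Q := by
  refine ext_of_forall_mem_subalgebra_integral_eq_of_polish (𝕜 := ℝ)
    cubePolynomials_separatesPoints fun g hg => ?_
  change g ∈ Algebra.adjoin ℝ _ at hg
  rw [← Subalgebra.mem_toSubmodule, Algebra.adjoin_eq_span] at hg
  induction hg using Submodule.span_induction with
  | mem g hg =>
    obtain ⟨L, hL, rfl⟩ := Submonoid.exists_list_of_mem_closure hg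
    have : ∃ l : List ι, ∀ x : ι → unitInterval, L.prod x = (l.map fun i => (x i : ℝ)).prod := by
      clear hg
      induction L with
      | nil => exact ⟨[], by simp⟩
      | cons f L ih =>
        obtain ⟨l, hl⟩ := ih fun y hy => hL y (List.mem_cons_of_mem _ hy)
        obtain ⟨i, rfl⟩ := hL f List.mem_cons_self
        exact ⟨i :: l, fun x => by simp [hl x]⟩
    obtain ⟨l, hl⟩ := this
    simp_rw [hl]
    exact h l
  | zero => simp
  | add f g _ _ hf hg =>
    simp only [BoundedContinuousFunction.coe_add, Pi.add_apply]
    rw [integral_add (f.integrable _) (g.integrable _),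
      integral_add (f.integrable _) (g.integrable _), hf, hg]
  | smul c f _ hf =>
    simp only [BoundedContinuousFunction.coe_smul]
    rw [integral_smul, integral_smul, hf]

theorem measure_ext_of_moments {P Q : Measure (ι → ℝ)} [IsProbabilityMeasure P]
    [IsProbabilityMeasure Q] (hP : ∀ᵐ x ∂P, ∀ i, x i ∈ Set.Icc (0 : ℝ) 1)
    (hQ : ∀ᵐ x ∂Q, ∀ i, x i ∈ Set.Icc (0 : ℝ) 1)
    (h : ∀ l : List ι, ∫⁻ x, (l.map fun i => ENNReal.ofReal (x i)).prod ∂P =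
      ∫⁻ x, (l.map fun i => ENNReal.ofReal (x i)).prod ∂Q) : P = Q := by
  -- Clamping to the cube is undone by the inclusion `v` almost everywhere, so nothing is lost by
  -- pushing both measures to the cube.
  let e : (ι → ℝ) → ι → unitInterval := fun x i => Set.projIcc 0 1 zero_le_one (x i)
  let v : (ι → unitInterval) → ι → ℝ := fun x i => x i
  have he : Measurable e := measurable_pi_lambda _ fun i =>
    continuous_projIcc.measurable.comp (measurable_pi_apply i)
  have hv : Measurable v := measurable_pi_lambda _ fun i =>
    measurable_subtype_coe.comp (measurable_pi_apply i)
  have hve : ∀ ν : Measure (ι → ℝ), (∀ᵐ x ∂ν, ∀ i, x i ∈ Set.Icc (0 : ℝ) 1) →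
      (ν.map e).map v = ν := fun ν hν => by
    rw [Measure.map_map hv he]
    conv_rhs => rw [← Measure.map_id (μ := ν)]
    refine Measure.map_congr ?_
    filter_upwards [hν] with x hx
    ext i
    simp [v, e, Set.projIcc_of_mem zero_le_one (hx i)]
  have hm : ∀ (ν : Measure (ι → ℝ)), (∀ᵐ x ∂ν, ∀ i, x i ∈ Set.Icc (0 : ℝ) 1) → ∀ l : List ι,
      ∫ x, (l.map fun i => (x i : ℝ)).prod ∂(ν.map e) =
        (∫⁻ x, (l.map fun i => ENNReal.ofReal (x i)).prod ∂ν).toReal := fun ν hν l => by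
    have hnn : ∀ x : ι → unitInterval, 0 ≤ (l.map fun i => (x i : ℝ)).prod := fun x =>
      List.prod_nonneg (by simp only [List.mem_map]; rintro _ ⟨i, -, rfl⟩; exact (x i).2.1)
    have hmeas : Measurable fun x : ι → unitInterval => (l.map fun i => (x i : ℝ)).prod := by
      induction l with
      | nil => simp
      | cons i l ih =>
        simp only [List.map_cons, List.prod_cons]
        exact (measurable_subtype_coe.comp (measurable_pi_apply i)).mul (ih fun x =>
          List.prod_nonneg (by simp only [List.mem_map]; rintro _ ⟨i, -, rfl⟩; exact (x i).2.1))
    rw [integral_eq_lintegral_of_nonneg_ae (Filter.Eventually.of_forall hnn)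
      hmeas.aestronglyMeasurable, lintegral_map hmeas.ennreal_ofReal he]
    congr 1
    refine lintegral_congr_ae ?_
    filter_upwards [hν] with x hx
    clear hnn hmeas
    induction l with
    | nil => simp
    | cons i l ih =>
      simp only [List.map_cons, List.prod_cons]
      rw [← ih, ENNReal.ofReal_mul (e x i).2.1]
      simp [e, Set.projIcc_of_mem zero_le_one (hx i)]
  have := Measure.isProbabilityMeasure_map (μ := P) he.aemeasurable
  have := Measure.isProbabilityMeasure_map (μ := Q) he.aemeasurable
  rw [← hve P hP, ← hve Q hQ,
    cube_measure_ext (P := P.map e) (Q := Q.map e) fun l => by rw [hm P hP, hm Q hQ, h]]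

end Moments

/-! ### Existence of a directing random measure -/

theorem exists_perm_extending {I : Finset ℕ} {τ : ℕ → ℕ} (hτ : τ.Injective) :
    ∃ (N : ℕ) (σ : Equiv.Perm (Fin N)) (hN : ∀ i ∈ I, i < N),
      ∀ i (hi : i ∈ I), (σ ⟨i, hN i hi⟩ : ℕ) = τ i := by
  classical
  obtain ⟨N, hN⟩ : ∃ N, ∀ i ∈ I, i < N ∧ τ i < N := by
    refine ⟨I.sup (fun i => max i (τ i)) + 1, fun i hi => ?_⟩
    have := Finset.le_sup (f := fun i => max i (τ i)) hi
    simp only [max_le_iff] at this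
    omega
  let p : Fin N → Prop := fun i => (i : ℕ) ∈ I
  let q : Fin N → Prop := fun j => ∃ i ∈ I, τ i = j
  let f : {x // p x} → {x // q x} := fun x => ⟨⟨τ x, (hN _ x.2).2⟩, x, x.2, rfl⟩
  have hf : f.Bijective := by
    refine ⟨fun x y h => ?_, fun y => ?_⟩
    · simp only [f, Subtype.mk.injEq, Fin.mk.injEq] at h
      exact Subtype.ext (Fin.ext (hτ h))
    · obtain ⟨⟨y, hy⟩, i, hi, hiy⟩ := y
      exact ⟨⟨⟨i, (hN i hi).1⟩, hi⟩, Subtype.ext (Fin.ext hiy)⟩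
  refine ⟨N, (Equiv.ofBijective f hf).extendSubtype, fun i hi => (hN i hi).1, fun i hi => ?_⟩
  rw [Equiv.extendSubtype_apply_of_mem (Equiv.ofBijective f hf) ⟨i, (hN i hi).1⟩ hi]
  rfl

section Exchangeable

variable {Ω 𝕏 : Type*} [MeasurableSpace Ω] [MeasurableSpace 𝕏] {X : ℕ → Ω → 𝕏} {μ : Measure Ω}

/-- On finitely many indices an injection agrees with a permutation of some initial segment, and
finite-dimensional laws determine the law of the sequence. This makes the shift and the deletion of
an entry available. -/
theorem Exchangeable.map_comp_injective [IsFiniteMeasure μ] (h : Exchangeable X μ)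
    (hX : ∀ n, Measurable (X n)) {τ : ℕ → ℕ} (hτ : τ.Injective) :
    μ.map (fun ω i => X (τ i) ω) = μ.map (fun ω i => X i ω) := by
  have hm : ∀ τ : ℕ → ℕ, Measurable fun ω i => X (τ i) ω := fun τ =>
    measurable_pi_lambda _ fun i => hX _
  refine IsProjectiveLimit.unique (P := fun I => (μ.map fun ω i => X i ω).map I.restrict)
    (fun I => ?_) fun I => rfl
  obtain ⟨N, σ, hN, hσ⟩ := exists_perm_extending (I := I) hτ
  have hr : Measurable fun (x : Fin N → 𝕏) (i : I) => x ⟨i, hN i i.2⟩ := by fun_prop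
  have := congrArg (Measure.map fun (x : Fin N → 𝕏) (i : I) => x ⟨i, hN i i.2⟩) (h N σ)
  rw [Measure.map_map hr (measurable_pi_lambda _ fun i => hX _),
    Measure.map_map hr (measurable_pi_lambda _ fun i => hX _)] at this
  change _ = (μ.map fun ω i => X (id i) ω).map I.restrict
  rw [Measure.map_map (Finset.measurable_restrict I) (hm _),
    Measure.map_map (Finset.measurable_restrict I) (hm id)]
  convert this using 2
  · ext ω i
    simp [hσ i i.2]
  · rfl

end Exchangeable

/-! ### The conditional law of the first entry given the rest -/

section Aldous

variable {𝕏 : Type*} [MeasurableSpace 𝕏]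

/-- The shift on sequences. -/
def seqShift (x : ℕ → 𝕏) : ℕ → 𝕏 := fun i => x (i + 1)

/-- Delete the entry of index one. -/
def seqSkip (x : ℕ → 𝕏) : ℕ → 𝕏 := fun i => x (if i = 0 then 0 else i + 1)

theorem measurable_seqShift : Measurable (seqShift (𝕏 := 𝕏)) :=
  measurable_pi_lambda _ fun _ => measurable_pi_apply _

theorem measurable_seqSkip : Measurable (seqSkip (𝕏 := 𝕏)) :=
  measurable_pi_lambda _ fun _ => measurable_pi_apply _

variable [StandardBorelSpace 𝕏] [Nonempty 𝕏]

/-- The conditional law of the first entry of a sequence given the others. -/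
noncomputable def headKernel (ν : Measure (ℕ → 𝕏)) [IsFiniteMeasure ν] : Kernel (ℕ → 𝕏) 𝕏 :=
  condDistrib (fun x => x 0) seqShift ν

instance (ν : Measure (ℕ → 𝕏)) [IsFiniteMeasure ν] : IsMarkovKernel (headKernel ν) := by
  rw [headKernel]; infer_instance

variable {ν : Measure (ℕ → 𝕏)} [IsProbabilityMeasure ν]

theorem lintegral_head_mul (hT : ν.map seqShift = ν) {A : Set 𝕏} (hA : MeasurableSet A)
    {g : (ℕ → 𝕏) → ℝ≥0∞} (hg : Measurable g) :
    ∫⁻ x, A.indicator 1 (x 0) * g (seqShift x) ∂ν = ∫⁻ x, headKernel ν x A * g x ∂ν := by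
  have h := compProd_map_condDistrib (mβ := MeasurableSpace.pi) (X := seqShift) (μ := ν)
    (measurable_pi_apply (X := fun _ : ℕ => 𝕏) 0).aemeasurable
  rw [hT] at h
  have hf : Measurable fun p : (ℕ → 𝕏) × 𝕏 => A.indicator (1 : 𝕏 → ℝ≥0∞) p.2 * g p.1 :=
    ((measurable_one.indicator hA).comp measurable_snd).mul (hg.comp measurable_fst)
  have h2 := lintegral_map (μ := ν) hf (measurable_seqShift.prodMk
    (measurable_pi_apply (X := fun _ : ℕ => 𝕏) 0))
  rw [← h, Measure.lintegral_compProd hf] at h2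
  rw [← h2]
  refine lintegral_congr fun x => ?_
  dsimp only
  rw [lintegral_mul_const _ (measurable_one.indicator hA), lintegral_indicator_one hA]
  rfl

/-- An L² argument: with k the conditional probability of `A` and T the shift, E[(k - k∘T)²] = 0,
because E[k²], E[(k∘T)²] and E[k · k∘T] coincide. -/
theorem headKernel_seqShift_apply (hT : ν.map seqShift = ν) (hU : ν.map seqSkip = ν)
    {A : Set 𝕏} (hA : MeasurableSet A) :
    ∀ᵐ x ∂ν, headKernel ν (seqShift x) A = headKernel ν x A := by
  let k : (ℕ → 𝕏) → ℝ≥0∞ := fun x => headKernel ν x A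
  have hk : Measurable k := Kernel.measurable_coe _ hA
  have hkT : Measurable fun x => k (seqShift x) := hk.comp measurable_seqShift
  have hk1 : ∀ x, k x ≤ 1 := fun x => prob_le_one
  have e1 : ∫⁻ x, k x * k x ∂ν = ∫⁻ x, k (seqShift x) * k (seqShift x) ∂ν := by
    conv_lhs => rw [← hT]
    exact lintegral_map (by fun_prop) measurable_seqShift
  -- Both sides are integrals of the indicator of x₀ ∈ A, against k of the sequence from index 2 on
  -- and from index 1 on respectively; deleting the entry of index 1 turns one into the other.
  have e2 : ∫⁻ x, k x * k (seqShift x) ∂ν = ∫⁻ x, k x * k x ∂ν := by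
    rw [← lintegral_head_mul hT hA hkT, ← lintegral_head_mul hT hA hk]
    have hm : Measurable fun x : ℕ → 𝕏 => A.indicator 1 (x 0) * k (seqShift x) :=
      ((measurable_one.indicator hA).comp (measurable_pi_apply 0)).mul hkT
    conv_rhs => rw [← hU]
    rw [lintegral_map hm measurable_seqSkip]
    rfl
  have hint : ∀ {f g : (ℕ → 𝕏) → ℝ≥0∞}, Measurable f → Measurable g → (∀ x, f x ≤ 1) →
      (∀ x, g x ≤ 1) → Integrable (fun x => (f x).toReal * (g x).toReal) ν ∧
      ∫ x, (f x).toReal * (g x).toReal ∂ν = (∫⁻ x, f x * g x ∂ν).toReal := by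
    intro f g hf hg hf1 hg1
    have hm : Measurable fun x => (f x).toReal * (g x).toReal := by fun_prop
    have hle : ∀ x, f x * g x ≤ 1 := fun x => mul_le_one' (hf1 x) (hg1 x)
    refine ⟨Integrable.of_bound hm.aestronglyMeasurable 1 (Filter.Eventually.of_forall fun x => ?_),
      ?_⟩
    · rw [← ENNReal.toReal_mul, Real.norm_of_nonneg ENNReal.toReal_nonneg]
      exact ENNReal.toReal_le_of_le_ofReal zero_le_one (by simpa using hle x)
    · simp_rw [← ENNReal.toReal_mul]
      exact integral_toReal (by fun_prop) (Filter.Eventually.of_forall fun x =>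
        (hle x).trans_lt ENNReal.one_lt_top)
  have i1 := hint hk hk hk1 hk1
  have i2 := hint hk hkT hk1 fun x => hk1 _
  have i3 := hint hkT hkT (fun x => hk1 _) fun x => hk1 _
  have j1 : Integrable (fun x => (k x).toReal * (k x).toReal -
      (k x).toReal * (k (seqShift x)).toReal) ν := i1.1.sub i2.1
  have j2 : Integrable (fun x => (k x).toReal * (k (seqShift x)).toReal -
      (k (seqShift x)).toReal * (k (seqShift x)).toReal) ν := i2.1.sub i3.1
  have hsq : ∀ x, ((k x).toReal - (k (seqShift x)).toReal) ^ 2 = (k x).toReal * (k x).toReal -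
      (k x).toReal * (k (seqShift x)).toReal - ((k x).toReal * (k (seqShift x)).toReal -
      (k (seqShift x)).toReal * (k (seqShift x)).toReal) := fun x => by ring
  have h0 : ∫ x, ((k x).toReal - (k (seqShift x)).toReal) ^ 2 ∂ν = 0 := by
    simp_rw [hsq]
    rw [integral_sub j1 j2, integral_sub i1.1 i2.1,
      integral_sub i2.1 i3.1, i1.2, i2.2, i3.2, e2, e1]
    ring
  rw [integral_eq_zero_iff_of_nonneg (fun x => sq_nonneg _)] at h0
  · filter_upwards [h0] with x hx
    have := sub_eq_zero.1 (pow_eq_zero_iff two_ne_zero |>.1 hx)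
    exact ((ENNReal.toReal_eq_toReal_iff' ((hk1 _).trans_lt ENNReal.one_lt_top).ne
      ((hk1 _).trans_lt ENNReal.one_lt_top).ne).1 this).symm
  · simp_rw [hsq]
    exact j1.sub j2

/-- The exceptional null set must not depend on `A`. Uniqueness of conditional distributions
provides this: the shifted kernel is another version of the same one. -/
theorem headKernel_seqShift (hT : ν.map seqShift = ν) (hU : ν.map seqSkip = ν) :
    ∀ᵐ x ∂ν, headKernel ν (seqShift x) = headKernel ν x := by
  have h := condDistrib_ae_eq_of_measure_eq_compProd_of_measurable (μ := ν) measurable_seqShift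
    (measurable_pi_apply (X := fun _ : ℕ => 𝕏) 0)
    (κ := (headKernel ν).comap seqShift measurable_seqShift) ?_
  · rw [hT] at h
    filter_upwards [h] with x hx
    exact hx.symm
  · rw [hT]
    refine Measure.ext_prod fun {B A} hB hA => ?_
    rw [Measure.compProd_apply_prod hB hA, Measure.map_apply (measurable_seqShift.prodMk
      (measurable_pi_apply (X := fun _ : ℕ => 𝕏) 0)) (hB.prod hA)]
    have h1 := lintegral_head_mul hT hA (g := B.indicator 1)
      (measurable_one.indicator hB)
    rw [← lintegral_indicator_one (measurable_seqShift.prodMk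
      (measurable_pi_apply (X := fun _ : ℕ => 𝕏) 0) (hB.prod hA)), ← lintegral_indicator hB]
    trans ∫⁻ x, A.indicator 1 (x 0) * B.indicator 1 (seqShift x) ∂ν
    · refine lintegral_congr fun x => ?_
      by_cases h1 : x 0 ∈ A <;> by_cases h2 : seqShift x ∈ B <;> simp [Set.indicator, h1, h2]
    · rw [h1]
      refine lintegral_congr_ae ?_
      filter_upwards [headKernel_seqShift_apply hT hU hA] with x hx
      by_cases h2 : x ∈ B <;> simp [Set.indicator, h2, hx]

/-- Entries are peeled off at the front. The kernel value produced is itself shift-invariant, so it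
joins the weight `h` in the induction. -/
theorem lintegral_prod_indicator_mul (hT : ν.map seqShift = ν) (hU : ν.map seqSkip = ν)
    (n : ℕ) {A : ℕ → Set 𝕏} (hA : ∀ i, MeasurableSet (A i)) {h : (ℕ → 𝕏) → ℝ≥0∞}
    (hm : Measurable h) (hh : ∀ᵐ x ∂ν, h (seqShift x) = h x) :
    ∫⁻ x, (∏ i ∈ Finset.range n, (A i).indicator 1 (x i)) * h x ∂ν =
      ∫⁻ x, (∏ i ∈ Finset.range n, headKernel ν x (A i)) * h x ∂ν := by
  induction n generalizing A h with
  | zero => simp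
  | succ n ih =>
    have hind : ∀ i j, Measurable fun x : ℕ → 𝕏 => (A i).indicator (1 : 𝕏 → ℝ≥0∞) (x j) :=
      fun i j => (measurable_one.indicator (hA i)).comp (measurable_pi_apply j)
    have hker : ∀ i, Measurable fun x => headKernel ν x (A i) := fun i =>
      Kernel.measurable_coe _ (hA i)
    let g : (ℕ → 𝕏) → ℝ≥0∞ := fun y =>
      (∏ i ∈ Finset.range n, (A (i + 1)).indicator 1 (y i)) * h y
    have hg : Measurable g :=
      (Finset.measurable_prod _ fun i _ => hind _ _).mul hm
    trans ∫⁻ x, (A 0).indicator 1 (x 0) * g (seqShift x) ∂ν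
    · refine lintegral_congr_ae ?_
      filter_upwards [hh] with x hx
      simp only [g, hx, Finset.prod_range_succ', seqShift]
      ring
    · rw [lintegral_head_mul hT (hA 0) hg]
      have := ih (A := fun i => A (i + 1)) (fun i => hA _) (h := fun x => headKernel ν x (A 0) * h x)
        ((hker 0).mul hm) (by
          filter_upwards [hh, headKernel_seqShift_apply hT hU (hA 0)] with x h1 h2
          rw [h1, h2])
      trans ∫⁻ x, (∏ i ∈ Finset.range n, (A (i + 1)).indicator 1 (x i)) *
        (headKernel ν x (A 0) * h x) ∂ν
      · refine lintegral_congr fun x => ?_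
        simp only [g]
        ring
      · rw [this]
        refine lintegral_congr fun x => ?_
        rw [Finset.prod_range_succ']
        ring

end Aldous

theorem Exchangeable.exists_isDirectingMeasure {Ω 𝕏 : Type*} [MeasurableSpace Ω]
    [MeasurableSpace 𝕏] [StandardBorelSpace 𝕏] [Nonempty 𝕏] {X : ℕ → Ω → 𝕏} {μ : Measure Ω}
    [IsProbabilityMeasure μ] (h : Exchangeable X μ) (hX : ∀ n, Measurable (X n)) :
    ∃ F : Ω → ProbabilityMeasure 𝕏, IsDirectingMeasure F X μ := by
  let seq : Ω → ℕ → 𝕏 := fun ω i => X i ω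
  have hseq : Measurable seq := measurable_pi_lambda _ hX
  let ν := μ.map seq
  have hν : IsProbabilityMeasure ν := Measure.isProbabilityMeasure_map hseq.aemeasurable
  have hT : ν.map seqShift = ν := by
    rw [Measure.map_map measurable_seqShift hseq]
    exact h.map_comp_injective hX (τ := fun i => i + 1) fun i j hij => by simpa using hij
  have hU : ν.map seqSkip = ν := by
    rw [Measure.map_map measurable_seqSkip hseq]
    refine h.map_comp_injective hX (τ := fun i => if i = 0 then 0 else i + 1) fun i j hij => ?_
    dsimp only at hij
    split_ifs at hij <;> omega
  let K : (ℕ → 𝕏) → ProbabilityMeasure 𝕏 := fun x => ⟨headKernel ν x, inferInstance⟩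
  have hK : Measurable K := (headKernel ν).measurable.subtype_mk
  have hKs : Measurable fun ω => K (seq ω) := hK.comp hseq
  refine ⟨fun ω => K (seq ω), hKs, fun n A hA => ?_⟩
  let A' : ℕ → Set 𝕏 := fun i => if hi : i < n then A ⟨i, hi⟩ else Set.univ
  have hA' : ∀ i, MeasurableSet (A' i) := fun i => by
    simp only [A']; split_ifs with hi
    · exact hA _
    · exact .univ
  have hAA' : ∀ i : Fin n, A' i = A i := fun i => by simp [A']
  have hE : MeasurableSet (⋂ i : Fin n, X i ⁻¹' A i) := MeasurableSet.iInter fun i => hX _ (hA i)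
  have hprod : ∀ ω, ∏ i : Fin n, (K (seq ω) : Measure 𝕏).real (A i) =
      (∏ i ∈ Finset.range n, headKernel ν (seq ω) (A' i)).toReal := fun ω => by
    rw [ENNReal.toReal_prod, Finset.prod_range]
    exact Finset.prod_congr rfl fun i _ => by rw [hAA']; rfl
  have hkm : Measurable fun x => ∏ i ∈ Finset.range n, headKernel ν x (A' i) :=
    Finset.measurable_prod _ fun i _ => Kernel.measurable_coe _ (hA' i)
  have hk1 : ∀ x, ∏ i ∈ Finset.range n, headKernel ν x (A' i) ≤ 1 := fun x =>
    Finset.prod_le_one' fun i _ => prob_le_one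
  have hmeas : Measurable[MeasurableSpace.comap (fun ω => K (seq ω)) inferInstance]
      fun ω => ∏ i : Fin n, (K (seq ω) : Measure 𝕏).real (A i) := by
    have : Measurable fun P : ProbabilityMeasure 𝕏 => ∏ i : Fin n, (P : Measure 𝕏).real (A i) :=
      Finset.measurable_prod _ fun i _ =>
        ((Measure.measurable_coe (hA i)).comp measurable_subtype_coe).ennreal_toReal
    exact this.comp (comap_measurable _)
  have hint : Integrable (fun ω => ∏ i : Fin n, (K (seq ω) : Measure 𝕏).real (A i)) μ := by
    refine Integrable.of_bound (hmeas.mono hKs.comap_le le_rfl).aestronglyMeasurable 1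
      (Filter.Eventually.of_forall fun ω => ?_)
    rw [Real.norm_of_nonneg (Finset.prod_nonneg fun i _ => measureReal_nonneg)]
    exact Finset.prod_le_one (fun i _ => measureReal_nonneg) fun i _ => measureReal_le_one
  symm
  refine ae_eq_condExp_of_forall_setIntegral_eq hKs.comap_le
    ((integrable_const _).indicator hE) (fun s _ _ => hint.integrableOn) ?_
    hmeas.stronglyMeasurable.aestronglyMeasurable
  rintro _ ⟨G, hG, rfl⟩ -
  have hG' : MeasurableSet (K ⁻¹' G) := hK hG
  -- Every event of the sigma-algebra of the directing measure has the form K ∈ G, and its indicator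
  -- is an admissible shift-invariant weight.
  have key := lintegral_prod_indicator_mul hT hU n hA' (h := (K ⁻¹' G).indicator 1)
    (measurable_one.indicator hG') (by
      filter_upwards [headKernel_seqShift hT hU] with x hx
      have : K (seqShift x) = K x := Subtype.ext hx
      by_cases hx' : x ∈ K ⁻¹' G
      · rw [Set.indicator_of_mem hx', Set.indicator_of_mem (by rwa [Set.mem_preimage, this])]
        rfl
      · rw [Set.indicator_of_notMem hx',
          Set.indicator_of_notMem (by rwa [Set.mem_preimage, this])])
  have hgm : Measurable fun x : ℕ → 𝕏 =>
      ∏ i ∈ Finset.range n, (A' i).indicator (1 : 𝕏 → ℝ≥0∞) (x i) :=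
    Finset.measurable_prod _ fun i _ =>
      (measurable_one.indicator (hA' i)).comp (measurable_pi_apply i)
  have hs : MeasurableSet ((fun ω => K (seq ω)) ⁻¹' G) := hKs hG
  have hone : Measurable ((K ⁻¹' G).indicator (1 : (ℕ → 𝕏) → ℝ≥0∞)) :=
    measurable_one.indicator hG'
  rw [lintegral_map (by fun_prop) hseq, lintegral_map (by fun_prop) hseq] at key
  have l1 : ∫⁻ ω, (∏ i ∈ Finset.range n, (A' i).indicator 1 (seq ω i)) *
      (K ⁻¹' G).indicator 1 (seq ω) ∂μ =
      μ ((⋂ i : Fin n, X i ⁻¹' A i) ∩ (fun ω => K (seq ω)) ⁻¹' G) := by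
    rw [← lintegral_indicator_one (hE.inter hs)]
    refine lintegral_congr fun ω => ?_
    rw [Set.inter_indicator_one]
    simp only [Pi.mul_apply]
    congr 1
    rw [Finset.prod_range]
    by_cases hω : ω ∈ ⋂ i : Fin n, X i ⁻¹' A i
    · rw [Set.indicator_of_mem hω]
      rw [Set.mem_iInter] at hω
      refine Finset.prod_eq_one fun i _ => ?_
      rw [hAA']
      exact Set.indicator_of_mem (s := A i) (a := seq ω i) (hω i) _
    · rw [Set.indicator_of_notMem hω]
      simp only [Set.mem_iInter, not_forall] at hω
      obtain ⟨i, hi⟩ := hω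
      refine Finset.prod_eq_zero (Finset.mem_univ i) ?_
      rw [hAA']
      exact Set.indicator_of_notMem (s := A i) (a := seq ω i) hi _
  have l2 : ∫⁻ ω, (∏ i ∈ Finset.range n, headKernel ν (seq ω) (A' i)) *
      (K ⁻¹' G).indicator 1 (seq ω) ∂μ =
      ∫⁻ ω in (fun ω => K (seq ω)) ⁻¹' G, ∏ i ∈ Finset.range n, headKernel ν (seq ω) (A' i) ∂μ := by
    rw [← lintegral_indicator hs]
    refine lintegral_congr fun ω => ?_
    by_cases hω : K (seq ω) ∈ G <;> simp [Set.indicator, hω]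
  rw [l1, l2] at key
  simp_rw [hprod]
  rw [integral_toReal (f := fun ω => ∏ i ∈ Finset.range n, headKernel ν (seq ω) (A' i))
    (hkm.comp hseq).aemeasurable (Filter.Eventually.of_forall fun ω =>
    (hk1 _).trans_lt ENNReal.one_lt_top), ← key, integral_indicator_const _ hE,
    measureReal_restrict_apply hE]
  simp [measureReal_def]

/-! ### Hit counts and words -/

section Words

variable {Ω 𝕏 : Type*} [MeasurableSpace Ω] [MeasurableSpace 𝕏] {X : ℕ → Ω → 𝕏} {μ : Measure Ω}

/-- The number of visits to `A` among the first `n` observations. -/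
noncomputable def hits (X : ℕ → Ω → 𝕏) (A : Set 𝕏) (n : ℕ) (ω : Ω) : ℕ :=
  ∑ i ∈ Finset.range n, A.indicator 1 (X i ω)

omit [MeasurableSpace Ω] [MeasurableSpace 𝕏] in
theorem hits_le (A : Set 𝕏) (n : ℕ) (ω : Ω) : hits X A n ω ≤ n := by
  refine (Finset.sum_le_card_nsmul _ _ 1 fun i _ => ?_).trans (by simp)
  by_cases h : X i ω ∈ A <;> simp [h]

theorem measurable_hits (hX : ∀ n, Measurable (X n)) {A : Set 𝕏} (hA : MeasurableSet A) (n : ℕ) :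
    Measurable (hits X A n) :=
  Finset.measurable_sum _ fun i _ => (measurable_one.indicator hA).comp (hX i)

omit [MeasurableSpace Ω] in
theorem empiricalDist_real {A : Set 𝕏} (hA : MeasurableSet A) (n : ℕ) (ω : Ω) :
    (empiricalDist X n ω).real A = (n : ℝ)⁻¹ * hits X A n ω := by
  have h1 : (∑ i ∈ Finset.range n, Measure.dirac (X i ω)) A = (hits X A n ω : ℝ≥0∞) := by
    rw [Measure.finsetSum_apply, hits, Nat.cast_sum]
    refine Finset.sum_congr rfl fun i _ => ?_
    rw [Measure.dirac_apply' _ hA]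
    by_cases h : X i ω ∈ A <;> simp [h]
  simp [empiricalDist, measureReal_def, h1]

theorem pastSigma_le (hX : ∀ n, Measurable (X n)) (n : ℕ) : pastSigma X n ≤ ‹MeasurableSpace Ω› :=
  (measurable_pi_lambda _ fun _ => hX _).comap_le

omit [MeasurableSpace Ω] in
theorem measurableSet_pastSigma_preimage {n i : ℕ} (hi : i < n) {A : Set 𝕏}
    (hA : MeasurableSet A) : MeasurableSet[pastSigma X n] (X i ⁻¹' A) :=
  ⟨(fun x : Fin n → 𝕏 => x ⟨i, hi⟩) ⁻¹' A, measurable_pi_apply _ hA, rfl⟩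

omit [MeasurableSpace Ω] in
theorem pastSigma_mono {m n : ℕ} (h : m ≤ n) : pastSigma X m ≤ pastSigma X n := by
  rintro _ ⟨S, hS, rfl⟩
  have : Measurable fun (x : Fin n → 𝕏) (i : Fin m) => x (Fin.castLE h i) := by fun_prop
  exact ⟨_, this hS, rfl⟩

/-- By Doob–Dynkin factorisation the conditional probability is a function of the count. The
integrated form over past events keeps later steps free of null sets. -/
theorem Sufficientness.exists_predictive [IsProbabilityMeasure μ] (h : Sufficientness X μ)
    (hX : ∀ n, Measurable (X n)) {n : ℕ} (hn : 1 ≤ n) {A : Set 𝕏} (hA : MeasurableSet A) :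
    ∃ f : ℕ → ℝ, ∀ E, MeasurableSet[pastSigma X n] E →
      μ.real (E ∩ X n ⁻¹' A) = ∫ ω in E, f (hits X A n ω) ∂μ := by
  have hsm : StronglyMeasurable[freqSigma X n A]
      (μ[(X n ⁻¹' A).indicator (fun _ => (1 : ℝ)) | freqSigma X n A]) :=
    stronglyMeasurable_condExp
  obtain ⟨φ, -, hφ⟩ := hsm.exists_eq_measurable_comp
  refine ⟨fun m => φ ((n : ℝ)⁻¹ * m), fun E hE => ?_⟩
  have hXA := hX n hA
  have h1 : ∫ ω in E, (X n ⁻¹' A).indicator (fun _ => (1 : ℝ)) ω ∂μ = μ.real (E ∩ X n ⁻¹' A) := by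
    rw [integral_indicator_const _ hXA, measureReal_restrict_apply hXA, smul_eq_mul, mul_one,
      Set.inter_comm]
  rw [← h1, ← setIntegral_condExp (pastSigma_le hX n) ((integrable_const _).indicator hXA) hE]
  refine integral_congr_ae (ae_restrict_of_ae ?_)
  filter_upwards [h n hn A hA] with ω hω
  rw [hω, hφ]
  simp only [Function.comp_apply, empiricalDist_real hA]

theorem setIntegral_hits [IsFiniteMeasure μ] (hX : ∀ n, Measurable (X n)) {A : Set 𝕏}
    (hA : MeasurableSet A) (n : ℕ) (E : Set Ω) :
    ∫ ω in E, (hits X A n ω : ℝ) ∂μ = ∑ i ∈ Finset.range n, μ.real (E ∩ X i ⁻¹' A) := by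
  have h1 : ∀ ω, (hits X A n ω : ℝ) =
      ∑ i ∈ Finset.range n, (X i ⁻¹' A).indicator (fun _ => (1 : ℝ)) ω := fun ω => by
    rw [hits, Nat.cast_sum]
    refine Finset.sum_congr rfl fun i _ => ?_
    by_cases h : X i ω ∈ A <;> simp [h]
  simp_rw [h1]
  rw [integral_finsetSum _ fun i _ => (integrable_const _).indicator (hX i hA)]
  refine Finset.sum_congr rfl fun i _ => ?_
  rw [integral_indicator_const _ (hX i hA), measureReal_restrict_apply (hX i hA), smul_eq_mul,
    mul_one, Set.inter_comm]

theorem integrable_hits [IsFiniteMeasure μ] (hX : ∀ n, Measurable (X n)) {A : Set 𝕏}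
    (hA : MeasurableSet A) (n : ℕ) : Integrable (fun ω => (hits X A n ω : ℝ)) μ :=
  Integrable.of_bound (measurable_from_top.comp (measurable_hits hX hA n)).aestronglyMeasurable n
    (Filter.Eventually.of_forall fun ω => by simpa using hits_le A n ω)

variable {ι : Type*}

/-- The event that the first observations spell the word `l` over the alphabet `A`; the most
recent letter comes first. -/
def wordEvent (X : ℕ → Ω → 𝕏) (A : ι → Set 𝕏) : List ι → Set Ω
  | [] => Set.univ
  | i :: l => wordEvent X A l ∩ X l.length ⁻¹' A i

omit [MeasurableSpace Ω] in
theorem measurableSet_wordEvent {A : ι → Set 𝕏} (hA : ∀ i, MeasurableSet (A i)) (l : List ι) :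
    MeasurableSet[pastSigma X l.length] (wordEvent X A l) := by
  induction l with
  | nil => exact MeasurableSet.univ
  | cons i l ih =>
    exact (pastSigma_mono (Nat.le_succ _) _ ih).inter
      (measurableSet_pastSigma_preimage (Nat.lt_succ_self _) (hA i))

omit [MeasurableSpace Ω] [MeasurableSpace 𝕏] in
theorem hits_of_mem_wordEvent [DecidableEq ι] {A : ι → Set 𝕏}
    (hd : Pairwise fun i j => Disjoint (A i) (A j)) (i : ι) {l : List ι} {ω : Ω}
    (h : ω ∈ wordEvent X A l) : hits X (A i) l.length ω = l.count i := by
  induction l with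
  | nil => simp [hits]
  | cons j l ih =>
    obtain ⟨h1, h2⟩ := h
    rw [List.length_cons, hits, Finset.sum_range_succ, ← hits, ih h1, List.count_cons]
    congr 1
    by_cases hij : j = i
    · subst hij
      have : X l.length ω ∈ A j := h2
      simp [this]
    · have : X l.length ω ∉ A i := fun h => Set.disjoint_left.1 (hd hij) h2 h
      simp [this, hij]

omit [MeasurableSpace Ω] [MeasurableSpace 𝕏] in
theorem exists_wordEvent_eq_iInter (X : ℕ → Ω → 𝕏) (A : ι → Set 𝕏) (l : List ι) :
    ∃ c : Fin l.length → ι, wordEvent X A l = (⋂ j : Fin l.length, X j ⁻¹' A (c j)) ∧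
      ∀ g : ι → ℝ, (l.map g).prod = ∏ j, g (c j) := by
  induction l with
  | nil => exact ⟨fun j => j.elim0, by simp [wordEvent], by simp⟩
  | cons i l ih =>
    obtain ⟨c, hc, hg⟩ := ih
    refine ⟨Fin.snoc (α := fun _ => ι) c i, ?_, fun g => ?_⟩
    · ext ω
      simp only [wordEvent, hc, Set.mem_inter_iff, Set.mem_iInter, Set.mem_preimage,
        List.length_cons]
      rw [Fin.forall_fin_succ']
      simp
    · simp only [List.map_cons, List.prod_cons, hg, List.length_cons]
      rw [Fin.prod_univ_castSucc]
      simp [mul_comm]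

end Words

/-! ### Pair probabilities and nonnegative correlation -/

section Pairs

variable {Ω 𝕏 : Type*} [MeasurableSpace Ω] [MeasurableSpace 𝕏] {X : ℕ → Ω → 𝕏} {μ : Measure Ω}
  [IsProbabilityMeasure μ]

theorem Exchangeable.real_pair (h : Exchangeable X μ) (hX : ∀ n, Measurable (X n)) {i j : ℕ}
    (hij : i ≠ j) {A B : Set 𝕏} (hA : MeasurableSet A) (hB : MeasurableSet B) :
    μ.real (X i ⁻¹' A ∩ X j ⁻¹' B) = μ.real (X 0 ⁻¹' A ∩ X 1 ⁻¹' B) := by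
  have hj : Equiv.swap 0 i j ≠ 0 := fun h => hij.symm (by
    simpa using Equiv.swap_apply_eq_iff.1 h)
  let τ : Equiv.Perm ℕ := (Equiv.swap 1 (Equiv.swap 0 i j)).trans (Equiv.swap 0 i)
  have h0 : τ 0 = i := by
    simp [τ, Equiv.swap_apply_of_ne_of_ne zero_ne_one hj.symm]
  have h1 : τ 1 = j := by simp [τ]
  have hS : MeasurableSet {x : ℕ → 𝕏 | x 0 ∈ A ∧ x 1 ∈ B} :=
    (measurable_pi_apply 0 hA).inter (measurable_pi_apply 1 hB)
  have := congrArg (fun m => m.real {x : ℕ → 𝕏 | x 0 ∈ A ∧ x 1 ∈ B})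
    (h.map_comp_injective hX τ.injective)
  rw [map_measureReal_apply (measurable_pi_lambda _ fun i => hX _) hS,
    map_measureReal_apply (measurable_pi_lambda _ fun i => hX _) hS] at this
  change μ.real (X (τ 0) ⁻¹' A ∩ X (τ 1) ⁻¹' B) = μ.real (X 0 ⁻¹' A ∩ X 1 ⁻¹' B) at this
  rwa [h0, h1] at this

theorem Exchangeable.real_single (h : Exchangeable X μ) (hX : ∀ n, Measurable (X n)) (i : ℕ)
    {A : Set 𝕏} (hA : MeasurableSet A) : μ.real (X i ⁻¹' A) = μ.real (X 0 ⁻¹' A) := by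
  have := h.real_pair hX (i := i) (j := i + 1) (by simp) hA MeasurableSet.univ
  simpa using this

theorem Exchangeable.real_pair_comm (h : Exchangeable X μ) (hX : ∀ n, Measurable (X n))
    {A B : Set 𝕏} (hA : MeasurableSet A) (hB : MeasurableSet B) :
    μ.real (X 0 ⁻¹' A ∩ X 1 ⁻¹' B) = μ.real (X 0 ⁻¹' B ∩ X 1 ⁻¹' A) := by
  rw [← h.real_pair hX one_ne_zero hB hA, Set.inter_comm]

/-- Exchangeable events are nonnegatively correlated. -/
theorem Exchangeable.sq_le_real_pair (h : Exchangeable X μ) (hX : ∀ n, Measurable (X n))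
    {A : Set 𝕏} (hA : MeasurableSet A) :
    μ.real (X 0 ⁻¹' A) ^ 2 ≤ μ.real (X 0 ⁻¹' A ∩ X 1 ⁻¹' A) := by
  set q := μ.real (X 0 ⁻¹' A)
  set k := μ.real (X 0 ⁻¹' A ∩ X 1 ⁻¹' A)
  -- This is the nonnegativity of the variance of the hit count, n q + n (n - 1) k - n² q², divided
  -- by n; large n then gives q² ≤ k.
  have key : ∀ n : ℕ, (n : ℝ) * (q ^ 2 - k) ≤ q - k := by
    intro n
    rcases n.eq_zero_or_pos with rfl | hn
    · have : k ≤ q := measureReal_mono Set.inter_subset_left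
      simpa using this
    have hH := measurable_hits hX hA n
    have hHr : Measurable fun ω => (hits X A n ω : ℝ) := measurable_from_top.comp hH
    have i1 : ∫ ω, (hits X A n ω : ℝ) ∂μ = n * q := by
      have := setIntegral_hits (μ := μ) hX hA n Set.univ
      simp only [Measure.restrict_univ, Set.univ_inter] at this
      rw [this, Finset.sum_congr rfl fun i _ => h.real_single hX i hA]
      simp [q]
    have hb : ∀ ω, |(hits X A n ω : ℝ)| ≤ n := fun ω => by simpa using hits_le A n ω
    have int1 : Integrable (fun ω => (hits X A n ω : ℝ)) μ := integrable_hits hX hA n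
    have int2 : Integrable (fun ω => (hits X A n ω : ℝ) ^ 2) μ :=
      Integrable.of_bound (hHr.pow_const 2).aestronglyMeasurable ((n : ℝ) ^ 2)
        (Filter.Eventually.of_forall fun ω => by
          rw [norm_pow, Real.norm_eq_abs]
          exact pow_le_pow_left₀ (abs_nonneg _) (hb ω) 2)
    have i2 : ∫ ω, (hits X A n ω : ℝ) ^ 2 ∂μ = n * q + n * (n - 1) * k := by
      have e1 : ∀ ω, (hits X A n ω : ℝ) ^ 2 =
          ∑ j ∈ Finset.range n, (X j ⁻¹' A).indicator (fun ω => (hits X A n ω : ℝ)) ω := fun ω => by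
        rw [sq]
        nth_rw 1 [hits]
        rw [Nat.cast_sum, Finset.sum_mul]
        refine Finset.sum_congr rfl fun j _ => ?_
        by_cases hj : X j ω ∈ A <;> simp [hj]
      simp_rw [e1]
      rw [integral_finsetSum _ fun j _ => int1.indicator (hX j hA)]
      have e2 : ∀ j ∈ Finset.range n,
          ∫ ω, (X j ⁻¹' A).indicator (fun ω => (hits X A n ω : ℝ)) ω ∂μ = q + (n - 1) * k := by
        intro j hj
        rw [integral_indicator (hX j hA), setIntegral_hits hX hA,
          ← Finset.add_sum_erase _ _ hj, Set.inter_self, h.real_single hX j hA,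
          Finset.sum_congr rfl fun i hi => h.real_pair hX (Finset.ne_of_mem_erase hi).symm hA hA,
          Finset.sum_const, Finset.card_erase_of_mem hj, Finset.card_range, nsmul_eq_mul,
          Nat.cast_pred hn]
      rw [Finset.sum_congr rfl e2]
      simp
      ring
    have i3 : 0 ≤ ∫ ω, ((hits X A n ω : ℝ) - n * q) ^ 2 ∂μ := integral_nonneg fun ω => sq_nonneg _
    have e3 : ∀ ω, ((hits X A n ω : ℝ) - n * q) ^ 2 =
        (hits X A n ω : ℝ) ^ 2 + (-(2 * (n * q)) * (hits X A n ω : ℝ) + (n * q) ^ 2) :=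
      fun ω => by ring
    simp_rw [e3] at i3
    have int3 : Integrable (fun ω => -(2 * (n * q)) * (hits X A n ω : ℝ) + (n * q) ^ 2) μ :=
      (int1.const_mul _).add (integrable_const _)
    rw [integral_add int2 int3,
      integral_add (int1.const_mul _) (integrable_const _), integral_const_mul, i1, i2,
      integral_const, probReal_univ, one_smul] at i3
    have hn' : (0 : ℝ) < n := by exact_mod_cast hn
    have : 0 ≤ (n : ℝ) * (q - k - n * (q ^ 2 - k)) := by nlinarith
    have := nonneg_of_mul_nonneg_right this hn'
    linarith
  by_contra hlt
  push Not at hlt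
  obtain ⟨n, hn⟩ := exists_nat_gt ((q - k) / (q ^ 2 - k))
  rw [div_lt_iff₀ (by linarith)] at hn
  linarith [key n]

end Pairs

/-! ### Splitting a law that is not carried by two points -/

section Splitting

variable {𝕏 : Type*} [MeasurableSpace 𝕏]

/-- The support carries all the mass, so it has at least three points; disjoint open neighbourhoods
of these have positive measure. -/
theorem exists_three_disjoint_pos [TopologicalSpace 𝕏] [T2Space 𝕏] [SecondCountableTopology 𝕏]
    [OpensMeasurableSpace 𝕏] {P : Measure 𝕏} [IsProbabilityMeasure P]
    (h : ∀ a b : 𝕏, P {a, b} ≠ 1) :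
    ∃ B : Fin 3 → Set 𝕏, (∀ i, MeasurableSet (B i)) ∧ Pairwise (fun i j => Disjoint (B i) (B j)) ∧
      ∀ i, 0 < P.real (B i) := by
  have hfull : ∀ a b : 𝕏, ¬ P.support ⊆ {a, b} := fun a b hab => h a b (by
    rw [← prob_compl_eq_zero_iff (Set.toFinite _).measurableSet]
    exact measure_mono_null (Set.compl_subset_compl.2 hab) Measure.measure_compl_support)
  obtain ⟨a, ha⟩ := P.nonempty_support (IsProbabilityMeasure.ne_zero P)
  obtain ⟨b, hb, hab⟩ := Set.not_subset.1 (hfull a a)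
  obtain ⟨c, hc, hcab⟩ := Set.not_subset.1 (hfull a b)
  simp only [Set.mem_insert_iff, Set.mem_singleton_iff, not_or, or_self] at hab hcab
  let x : Fin 3 → 𝕏 := ![a, b, c]
  have hx : x.Injective := by
    intro i j hij
    fin_cases i <;> fin_cases j <;> simp_all [x, eq_comm]
  obtain ⟨U, hU, hd⟩ := Set.Finite.t2_separation (Set.finite_range x)
  have hs : ∀ i, x i ∈ P.support := by
    intro i; fin_cases i <;> simpa [x]
  refine ⟨fun i => U (x i), fun i => (hU _).2.measurableSet,
    fun i j hij => hd ⟨i, rfl⟩ ⟨j, rfl⟩ fun h => hij (hx h), fun i => ?_⟩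
  rw [measureReal_def, ENNReal.toReal_pos_iff]
  exact ⟨(Measure.mem_support_iff_forall _).1 (hs i) _ ((hU _).2.mem_nhds (hU _).1),
    measure_lt_top _ _⟩

/-- Pigeonhole: each of the three sets meets `A` or its complement in positive measure, so two of
them do so on the same side. -/
theorem exists_split {P : Measure 𝕏} [IsProbabilityMeasure P] {B : Fin 3 → Set 𝕏}
    (hB : ∀ i, MeasurableSet (B i)) (hd : Pairwise fun i j => Disjoint (B i) (B j))
    (hpos : ∀ i, 0 < P.real (B i)) {A : Set 𝕏} (hA : MeasurableSet A) :
    ∃ C D : Set 𝕏, MeasurableSet C ∧ MeasurableSet D ∧ Disjoint C D ∧ 0 < P.real C ∧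
      0 < P.real D ∧ (C ∪ D = A ∨ C ∪ D = Aᶜ) := by
  have split : ∀ {S : Set 𝕏}, MeasurableSet S → (S = A ∨ S = Aᶜ) → ∀ {i j : Fin 3}, i ≠ j →
      0 < P.real (S ∩ B i) → 0 < P.real (S ∩ B j) →
      ∃ C D : Set 𝕏, MeasurableSet C ∧ MeasurableSet D ∧ Disjoint C D ∧ 0 < P.real C ∧
      0 < P.real D ∧ (C ∪ D = A ∨ C ∪ D = Aᶜ) := by
    intro S hS hSA i j hij hi hj
    refine ⟨S ∩ B i, S \ B i, hS.inter (hB i), hS.diff (hB i), ?_, hi, hj.trans_le ?_, ?_⟩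
    · exact Set.disjoint_left.2 fun x h1 h2 => h2.2 h1.2
    · exact measureReal_mono fun x hx => ⟨hx.1, fun h => Set.disjoint_left.1 (hd hij) h hx.2⟩
    · rwa [Set.inter_union_sdiff]
  have cases : ∀ i, 0 < P.real (A ∩ B i) ∨ 0 < P.real (Aᶜ ∩ B i) := by
    intro i
    by_contra! h
    have h1 := measureReal_inter_add_sdiff (μ := P) (s := B i) hA
    rw [Set.sdiff_eq, Set.inter_comm, Set.inter_comm (B i) Aᶜ] at h1
    linarith [hpos i]
  have h01 : (0 : Fin 3) ≠ 1 := by decide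
  have h02 : (0 : Fin 3) ≠ 2 := by decide
  have h12 : (1 : Fin 3) ≠ 2 := by decide
  have sA := @split A hA (Or.inl rfl)
  have sC := @split Aᶜ hA.compl (Or.inr rfl)
  rcases cases 0 with h0 | h0 <;> rcases cases 1 with h1 | h1
  · exact sA h01 h0 h1
  · rcases cases 2 with h2 | h2
    · exact sA h02 h0 h2
    · exact sC h12 h1 h2
  · rcases cases 2 with h2 | h2
    · exact sA h12 h1 h2
    · exact sC h02 h0 h2
  · exact sC h01 h0 h1

end Splitting

/-! ### The predictive rule -/

section Predictive

variable {Ω 𝕏 : Type*} [MeasurableSpace Ω] [MeasurableSpace 𝕏] {X : ℕ → Ω → 𝕏} {μ : Measure Ω}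

/-- Given the first `n` observations, the probability that the next one falls into `A` is the
mixture of the prior guess and the empirical frequency determined by the correlation `t`. -/
def IsPredictive (X : ℕ → Ω → 𝕏) (μ : Measure Ω) (t : ℝ) (n : ℕ) (A : Set 𝕏) : Prop :=
  ∀ E, MeasurableSet[pastSigma X n] E →
    μ.real (E ∩ X n ⁻¹' A) * (1 + ((n : ℝ) - 1) * t) =
      (1 - t) * μ.real (X 0 ⁻¹' A) * μ.real E + t * ∑ i ∈ Finset.range n, μ.real (E ∩ X i ⁻¹' A)

theorem one_add_pred_mul_pos {t : ℝ} (h0 : 0 ≤ t) (h1 : t < 1) (n : ℕ) :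
    0 < 1 + ((n : ℝ) - 1) * t := by
  have : 0 ≤ (n : ℝ) * t := by positivity
  linarith

variable [IsProbabilityMeasure μ]

theorem real_inter_add_inter_compl (hX : ∀ n, Measurable (X n)) {A : Set 𝕏}
    (hA : MeasurableSet A) (E : Set Ω) (i : ℕ) :
    μ.real (E ∩ X i ⁻¹' A) + μ.real (E ∩ X i ⁻¹' Aᶜ) = μ.real E := by
  rw [Set.preimage_compl, ← Set.sdiff_eq, measureReal_inter_add_sdiff (hX i hA)]

theorem IsPredictive.compl (hX : ∀ n, Measurable (X n)) {t : ℝ} {n : ℕ} {A : Set 𝕏}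
    (hA : MeasurableSet A) (h : IsPredictive X μ t n A) : IsPredictive X μ t n Aᶜ := by
  intro E hE
  have h1 := h E hE
  have h2 := real_inter_add_inter_compl (μ := μ) hX hA E n
  have h3 := real_inter_add_inter_compl (μ := μ) hX hA Set.univ 0
  simp only [Set.univ_inter, probReal_univ] at h3
  have h4 : ∑ i ∈ Finset.range n, μ.real (E ∩ X i ⁻¹' A) +
      ∑ i ∈ Finset.range n, μ.real (E ∩ X i ⁻¹' Aᶜ) = n * μ.real E := by
    rw [← Finset.sum_add_distrib, Finset.sum_congr rfl fun i _ =>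
      real_inter_add_inter_compl (μ := μ) hX hA E i]
    simp
  rw [eq_sub_of_add_eq' h2, eq_sub_of_add_eq' h3, eq_sub_of_add_eq' h4]
  linear_combination -h1

theorem isPredictive_of_null (hX : ∀ n, Measurable (X n)) (hexch : Exchangeable X μ) (t : ℝ)
    (n : ℕ) {A : Set 𝕏} (hA : MeasurableSet A) (h : μ.real (X 0 ⁻¹' A) = 0) :
    IsPredictive X μ t n A := by
  intro E _
  have h0 : ∀ i, μ.real (E ∩ X i ⁻¹' A) = 0 := fun i =>
    le_antisymm ((measureReal_mono Set.inter_subset_right).trans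
      (by rw [hexch.real_single hX i hA, h])) measureReal_nonneg
  simp [h0, h]

theorem isPredictive_zero (t : ℝ) (A : Set 𝕏) : IsPredictive X μ t 0 A := by
  rintro _ ⟨S, -, rfl⟩
  rcases Set.eq_empty_or_nonempty S with rfl | ⟨x, hx⟩
  · simp
  · have : S = Set.univ := Set.eq_univ_of_forall fun y => by rwa [Subsingleton.elim y x]
    simp [this]
    ring

variable {ι : Type*}

/-- The prior term of the rule has weight 1 - t > 0, so no letter is ever excluded. Hence identities
between predictive functions can be read off at every count vector. -/
theorem wordEvent_pos {t : ℝ} (h0 : 0 ≤ t) (h1 : t < 1) {A : ι → Set 𝕏}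
    (hA : ∀ i, MeasurableSet (A i)) (hpos : ∀ i, 0 < μ.real (X 0 ⁻¹' A i)) (l : List ι)
    (hp : ∀ k < l.length, ∀ i, IsPredictive X μ t k (A i)) : 0 < μ.real (wordEvent X A l) := by
  induction l with
  | nil => simp [wordEvent]
  | cons i l ih =>
    have ih := ih fun k hk => hp k (hk.trans (Nat.lt_succ_self _))
    have h := hp l.length (Nat.lt_succ_self _) i _ (measurableSet_wordEvent hA l)
    have hd := one_add_pred_mul_pos h0 h1 l.length
    have hr : 0 < (1 - t) * μ.real (X 0 ⁻¹' A i) * μ.real (wordEvent X A l) :=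
      mul_pos (mul_pos (by linarith) (hpos i)) ih
    have hs : 0 ≤ t * ∑ j ∈ Finset.range l.length, μ.real (wordEvent X A l ∩ X j ⁻¹' A i) :=
      mul_nonneg h0 (Finset.sum_nonneg fun _ _ => measureReal_nonneg)
    exact pos_of_mul_pos_left (by rw [wordEvent]; linarith) hd.le

theorem sum_real_inter_preimage_of_partition [Fintype ι] (hX : ∀ n, Measurable (X n))
    {A : ι → Set 𝕏} (hA : ∀ i, MeasurableSet (A i))
    (hd : Pairwise fun i j => Disjoint (A i) (A j)) (hU : ⋃ i, A i = Set.univ) (E : Set Ω) (n : ℕ) :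
    ∑ i, μ.real (E ∩ X n ⁻¹' A i) = μ.real E := by
  have h1 : ∀ i, μ.real (E ∩ X n ⁻¹' A i) = (μ.restrict E).real (X n ⁻¹' A i) := fun i => by
    rw [measureReal_restrict_apply (hX n (hA i)), Set.inter_comm]
  simp_rw [h1]
  rw [← measureReal_biUnion_finset (fun i _ j _ hij => (hd hij).preimage _)
    fun i _ => hX n (hA i)]
  have h2 : ⋃ i ∈ Finset.univ, X n ⁻¹' A i = Set.univ := by
    simp [← Set.preimage_iUnion, hU]
  rw [h2, measureReal_restrict_apply .univ, Set.univ_inter]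

/-- On partitions into three sets of positive probability the predictive probabilities depend
linearly on the counts. -/
theorem exists_linear_predictive (hX : ∀ n, Measurable (X n)) (hsuff : Sufficientness X μ)
    {t : ℝ} (h0 : 0 ≤ t) (h1 : t < 1) {A : Fin 3 → Set 𝕏}
    (hA : ∀ i, MeasurableSet (A i)) (hd : Pairwise fun i j => Disjoint (A i) (A j))
    (hU : ⋃ i, A i = Set.univ) (hpos : ∀ i, 0 < μ.real (X 0 ⁻¹' A i)) {n : ℕ}
    (hp : ∀ k ≤ n, ∀ i, IsPredictive X μ t k (A i)) :
    ∃ c d : ℝ, ∀ E, MeasurableSet[pastSigma X (n + 1)] E →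
      μ.real (E ∩ X (n + 1) ⁻¹' A 0) =
        c * μ.real E + d * ∑ i ∈ Finset.range (n + 1), μ.real (E ∩ X i ⁻¹' A 0) := by
  choose f hf using fun i => hsuff.exists_predictive hX (Nat.succ_pos n) (hA i)
  have hsum : ∀ l : List (Fin 3), l.length = n + 1 → ∑ i, f i (l.count i) = 1 := by
    intro l hl
    have hw := wordEvent_pos h0 h1 hA hpos l fun k hk => hp k (by omega)
    have hm := measurableSet_wordEvent (X := X) hA l
    rw [hl] at hm
    have h2 : ∀ i, μ.real (wordEvent X A l ∩ X (n + 1) ⁻¹' A i) =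
        f i (l.count i) * μ.real (wordEvent X A l) := by
      intro i
      rw [Nat.succ_eq_add_one] at hf
      rw [hf i _ hm, setIntegral_congr_fun (g := fun _ => f i (l.count i))
        (pastSigma_le hX _ _ hm) fun ω hω => ?_]
      · simp [mul_comm]
      · have := hits_of_mem_wordEvent hd i hω
        rw [hl] at this
        simp only [this]
    have h3 := sum_real_inter_preimage_of_partition (μ := μ) hX hA hd hU (wordEvent X A l) (n + 1)
    simp_rw [h2] at h3
    rw [← Finset.sum_mul] at h3
    exact mul_right_cancel₀ hw.ne' (by rw [h3, one_mul])
  -- Two words differing only in one letter, 0 against 1, are compared. The third cell pads the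
  -- length and cancels, so the increment does not depend on `i`.
  have hdiff : ∀ i ≤ n, f 0 (i + 1) - f 0 i = f 1 1 - f 1 0 := by
    intro i hi
    have e0 := hsum (0 :: (List.replicate i 0 ++ List.replicate (n - i) 2)) (by simp; omega)
    have e1 := hsum (1 :: (List.replicate i 0 ++ List.replicate (n - i) 2)) (by simp; omega)
    simp [Fin.sum_univ_three, List.count_cons, List.count_append, List.count_replicate] at e0 e1
    linarith
  have hlin : ∀ m ≤ n + 1, f 0 m = f 0 0 + (f 1 1 - f 1 0) * m := by
    intro m hm
    induction m with
    | zero => simp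
    | succ m ih =>
      have := hdiff m (by omega)
      have := ih (by omega)
      push_cast
      linarith
  refine ⟨f 0 0, f 1 1 - f 1 0, fun E hE => ?_⟩
  rw [Nat.succ_eq_add_one] at hf
  rw [hf 0 E hE, ← setIntegral_hits hX (hA 0), ← integral_const_mul]
  have hc : ∫ ω in E, f 0 0 ∂μ = f 0 0 * μ.real E := by simp [mul_comm]
  rw [← hc, ← integral_add (integrable_const _)
    ((integrable_hits hX (hA 0) _).integrableOn.const_mul _)]
  refine integral_congr_ae (Filter.Eventually.of_forall fun ω => ?_)
  exact hlin _ (hits_le _ _ _)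

/-- Two past events suffice to identify the affine coefficients: the sure event, and the first
observation falling in the cell. The second brings in the correlation. -/
theorem isPredictive_succ_of_partition (hX : ∀ n, Measurable (X n)) (hexch : Exchangeable X μ)
    (hsuff : Sufficientness X μ) {t : ℝ} (h0 : 0 ≤ t) (h1 : t < 1) {A : Fin 3 → Set 𝕏}
    (hA : ∀ i, MeasurableSet (A i)) (hd : Pairwise fun i j => Disjoint (A i) (A j))
    (hU : ⋃ i, A i = Set.univ) (hpos : ∀ i, 0 < μ.real (X 0 ⁻¹' A i))
    (ht : μ.real (X 0 ⁻¹' A 0 ∩ X 1 ⁻¹' A 0) = μ.real (X 0 ⁻¹' A 0) ^ 2 +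
      t * μ.real (X 0 ⁻¹' A 0) * (1 - μ.real (X 0 ⁻¹' A 0))) {n : ℕ}
    (hp : ∀ k ≤ n, ∀ i, IsPredictive X μ t k (A i)) : IsPredictive X μ t (n + 1) (A 0) := by
  obtain ⟨c, d, hcd⟩ := exists_linear_predictive hX hsuff h0 h1 hA hd hU hpos hp
  set q := μ.real (X 0 ⁻¹' A 0) with hq
  have e1 := hcd Set.univ .univ
  simp only [Set.univ_inter, probReal_univ, mul_one] at e1
  rw [Finset.sum_congr rfl fun i _ => hexch.real_single hX i (hA 0),
    hexch.real_single hX _ (hA 0), ← hq] at e1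
  have e2 := hcd (X 0 ⁻¹' A 0) (measurableSet_pastSigma_preimage n.succ_pos (hA 0))
  rw [Finset.sum_range_succ', Set.inter_self,
    Finset.sum_congr rfl fun i _ => hexch.real_pair hX (Nat.succ_ne_zero i).symm (hA 0) (hA 0),
    hexch.real_pair hX n.succ_ne_zero.symm (hA 0) (hA 0), ht, ← hq] at e2
  simp only [Finset.sum_const, Finset.card_range, nsmul_eq_mul] at e1 e2
  push_cast at e1
  have hq0 : 0 < q := hpos 0
  have hq1 : q < 1 := by
    have := sum_real_inter_preimage_of_partition (μ := μ) hX hA hd hU Set.univ 0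
    simp only [Set.univ_inter, probReal_univ, Fin.sum_univ_three] at this
    linarith [hpos 1, hpos 2]
  have e3 : d * (1 + n * t) = t := by
    have : (d * (1 + n * t) - t) * (q * (1 - q)) = 0 := by
      linear_combination q * e1 - e2
    rcases mul_eq_zero.1 this with h | h
    · linarith
    · exact absurd h (mul_pos hq0 (by linarith)).ne'
  intro E hE
  rw [hcd E hE]
  push_cast
  have e4 : c * (1 + n * t) = (1 - t) * q := by
    linear_combination (-(1 + n * t)) * e1 - (n + 1) * q * e3
  rw [← hq]
  linear_combination μ.real E * e4 + (∑ i ∈ Finset.range (n + 1), μ.real (E ∩ X i ⁻¹' A 0)) * e3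

end Predictive

/-! ### Johnson's theorem -/

section Johnson

variable {Ω 𝕏 : Type*} [MeasurableSpace Ω] [MeasurableSpace 𝕏] {X : ℕ → Ω → 𝕏} {μ : Measure Ω}
  [IsProbabilityMeasure μ]

/-- Under sufficientness, the correlation between the events `X 0 ∈ A` and `X 1 ∈ A` does not
depend on `A`. -/
theorem exists_correlation (hX : ∀ n, Measurable (X n)) (hexch : Exchangeable X μ)
    (hsuff : Sufficientness X μ) {B₁ B₂ : Set 𝕏} (hB₁ : MeasurableSet B₁) (hB₂ : MeasurableSet B₂)
    (hd : Disjoint B₁ B₂) (hpos₁ : 0 < μ.real (X 0 ⁻¹' B₁)) (hpos₂ : 0 < μ.real (X 0 ⁻¹' B₂)) :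
    ∃ t : ℝ, ∀ A, MeasurableSet A → μ.real (X 0 ⁻¹' A ∩ X 1 ⁻¹' A) = μ.real (X 0 ⁻¹' A) ^ 2 +
      t * μ.real (X 0 ⁻¹' A) * (1 - μ.real (X 0 ⁻¹' A)) := by
  have hρ : ∀ A : Set 𝕏, ∃ r : ℝ, MeasurableSet A → ∀ B, MeasurableSet B → Disjoint A B →
      μ.real (X 0 ⁻¹' B ∩ X 1 ⁻¹' A) = r * μ.real (X 0 ⁻¹' B) := by
    intro A
    by_cases hA : MeasurableSet A
    · obtain ⟨f, hf⟩ := hsuff.exists_predictive hX le_rfl hA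
      refine ⟨f 0, fun _ B hB hAB => ?_⟩
      rw [hf _ (measurableSet_pastSigma_preimage one_pos hB),
        setIntegral_congr_fun (g := fun _ => f 0) (hX 0 hB) fun ω hω => ?_]
      · simp [mul_comm]
      · have : X 0 ω ∉ A := fun h => Set.disjoint_left.1 hAB h hω
        simp [hits, this]
    · exact ⟨0, fun h => absurd h hA⟩
  choose r hr using hρ
  set q : Set 𝕏 → ℝ := fun A => μ.real (X 0 ⁻¹' A) with hq
  have hsymm : ∀ A B, MeasurableSet A → MeasurableSet B → Disjoint A B →
      r A * q B = r B * q A := fun A B hA hB hAB => by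
    rw [← hr A hA B hB hAB, ← hr B hB A hA hAB.symm, hexch.real_pair_comm hX hA hB]
  have hcompl : ∀ A, MeasurableSet A → q A + q Aᶜ = 1 := fun A hA => by
    have := real_inter_add_inter_compl (μ := μ) hX hA Set.univ 0
    rwa [Set.univ_inter, Set.univ_inter, probReal_univ] at this
  have hsplit : ∀ A B, MeasurableSet A → MeasurableSet B → q (A ∩ B) + q (Aᶜ ∩ B) = q B :=
    fun A B hA hB => by
      have := real_inter_add_inter_compl (μ := μ) hX hA (X 0 ⁻¹' B) 0
      rwa [← Set.preimage_inter, ← Set.preimage_inter, Set.inter_comm, Set.inter_comm B] at this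
  set s := r B₁ / q B₁ with hs
  have hB₁s : r B₁ = s * q B₁ := by rw [hs, div_mul_cancel₀ _ hpos₁.ne']
  -- The ratio r/q = s passes between disjoint sets; only the set it comes from needs positive mass.
  have trans : ∀ A B, MeasurableSet A → MeasurableSet B → Disjoint A B → 0 < q B →
      r B = s * q B → r A = s * q A := fun A B hA hB hAB hqB h => by
    have := hsymm A B hA hB hAB
    rw [h] at this
    exact mul_right_cancel₀ hqB.ne' (by rw [this]; ring)
  -- The ratio travels from `B₁` to a piece of `B₂` on one side of `A`, then to `A`, passing through
  -- the complement if the piece lies inside `A`.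
  have hall : ∀ A, MeasurableSet A → 0 < q A → 0 < q Aᶜ → r A = s * q A := by
    intro A hA h1 h2
    have hdis : ∀ D, Disjoint (D ∩ B₂) B₁ := fun D =>
      hd.symm.mono_left Set.inter_subset_right
    have hrD : ∀ D, MeasurableSet D → r (D ∩ B₂) = s * q (D ∩ B₂) := fun D hD =>
      trans _ _ (hD.inter hB₂) hB₁ (hdis D) hpos₁ hB₁s
    rcases lt_or_ge 0 (q (Aᶜ ∩ B₂)) with h3 | h3
    · exact trans _ _ hA (hA.compl.inter hB₂)
        (disjoint_compl_right.mono_right Set.inter_subset_left) h3 (hrD _ hA.compl)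
    · have h4 : 0 < q (A ∩ B₂) := by
        have : 0 < q B₂ := hpos₂
        linarith [hsplit A B₂ hA hB₂]
      refine trans _ _ hA hA.compl disjoint_compl_right h2 ?_
      exact trans _ _ hA.compl (hA.inter hB₂)
        (disjoint_compl_left.mono_right Set.inter_subset_left) h4 (hrD _ hA)
  refine ⟨1 - s, fun A hA => ?_⟩
  change _ = q A ^ 2 + (1 - s) * q A * (1 - q A)
  have hk : μ.real (X 0 ⁻¹' A ∩ X 1 ⁻¹' A) = q A - r A * q Aᶜ := by
    have h1 := real_inter_add_inter_compl (μ := μ) hX hA (X 1 ⁻¹' A) 0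
    rw [Set.inter_comm, Set.inter_comm _ (X 0 ⁻¹' Aᶜ), hr A hA Aᶜ hA.compl disjoint_compl_right,
      hexch.real_single hX 1 hA] at h1
    simp only [hq]
    linarith
  have hc := hcompl A hA
  have hnn : 0 ≤ q A := measureReal_nonneg
  have hnc : 0 ≤ q Aᶜ := measureReal_nonneg
  rcases hnn.eq_or_lt with h | h
  · have : μ.real (X 0 ⁻¹' A ∩ X 1 ⁻¹' A) ≤ q A := measureReal_mono Set.inter_subset_left
    rw [← h] at this ⊢
    rw [le_antisymm this measureReal_nonneg]
    ring
  · rcases hnc.eq_or_lt with h' | h'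
    · rw [hk, ← h']
      rw [← h', add_zero] at hc
      rw [hc]; ring
    · rw [hk, hall A hA h h', eq_sub_of_add_eq' hc]
      ring

theorem correlation_nonneg (hX : ∀ n, Measurable (X n)) (hexch : Exchangeable X μ) {t : ℝ}
    {A : Set 𝕏} (hA : MeasurableSet A) (h0 : 0 < μ.real (X 0 ⁻¹' A)) (h1 : μ.real (X 0 ⁻¹' A) < 1)
    (ht : μ.real (X 0 ⁻¹' A ∩ X 1 ⁻¹' A) = μ.real (X 0 ⁻¹' A) ^ 2 +
      t * μ.real (X 0 ⁻¹' A) * (1 - μ.real (X 0 ⁻¹' A))) : 0 ≤ t := by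
  have h := hexch.sq_le_real_pair hX hA
  rw [ht] at h
  by_contra! hlt
  have : 0 < -t * (μ.real (X 0 ⁻¹' A) * (1 - μ.real (X 0 ⁻¹' A))) :=
    mul_pos (by linarith) (mul_pos h0 (by linarith))
  linarith

/-- P(X₀ ∈ U, X₁ ∉ U) = (1 - t) q(U) (1 - q(U)), so t ≥ 1 makes it vanish. A countable basis and the
Hausdorff property then give X₀ = X₁ almost surely. -/
theorem correlation_lt_one [TopologicalSpace 𝕏] [SecondCountableTopology 𝕏] [T2Space 𝕏]
    [OpensMeasurableSpace 𝕏] (hX : ∀ n, Measurable (X n)) (hneq : ¬ X 0 =ᵐ[μ] X 1) {t : ℝ}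
    (ht : ∀ A, MeasurableSet A → μ.real (X 0 ⁻¹' A ∩ X 1 ⁻¹' A) = μ.real (X 0 ⁻¹' A) ^ 2 +
      t * μ.real (X 0 ⁻¹' A) * (1 - μ.real (X 0 ⁻¹' A))) : t < 1 := by
  by_contra! h1
  refine hneq ?_
  have key : ∀ U ∈ TopologicalSpace.countableBasis 𝕏, ∀ᵐ ω ∂μ, X 0 ω ∈ U → X 1 ω ∈ U := by
    intro U hU
    have hUm := (TopologicalSpace.isOpen_of_mem_countableBasis hU).measurableSet
    have h2 := real_inter_add_inter_compl (μ := μ) hX hUm (X 0 ⁻¹' U) 1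
    rw [ht U hUm] at h2
    have h3 : 0 ≤ (t - 1) * (μ.real (X 0 ⁻¹' U) * (1 - μ.real (X 0 ⁻¹' U))) :=
      mul_nonneg (by linarith) (mul_nonneg measureReal_nonneg
        (sub_nonneg.2 measureReal_le_one))
    have h4 : μ.real (X 0 ⁻¹' U ∩ X 1 ⁻¹' Uᶜ) = 0 :=
      le_antisymm (by linarith) measureReal_nonneg
    rw [measureReal_eq_zero_iff] at h4
    filter_upwards [measure_eq_zero_iff_ae_notMem.1 h4] with ω hω h5
    by_contra h6
    exact hω ⟨h5, h6⟩
  filter_upwards [(ae_ball_iff (TopologicalSpace.countable_countableBasis 𝕏)).2 key] with ω hω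
  by_contra hne
  obtain ⟨U, V, hU, -, hxU, hyV, hUV⟩ := t2_separation hne
  obtain ⟨W, hW, hxW, hWU⟩ := (TopologicalSpace.isBasis_countableBasis 𝕏).exists_subset_of_mem_open
    hxU hU
  exact Set.disjoint_left.1 hUV (hWU (hω W hW hxW)) hyV

/-- Johnson's predictive rule. -/
theorem isPredictive_of_sufficientness (hX : ∀ n, Measurable (X n)) (hexch : Exchangeable X μ)
    (hsuff : Sufficientness X μ) {B : Fin 3 → Set 𝕏} (hB : ∀ i, MeasurableSet (B i))
    (hd : Pairwise fun i j => Disjoint (B i) (B j)) (hpos : ∀ i, 0 < μ.real (X 0 ⁻¹' B i)) {t : ℝ}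
    (h0 : 0 ≤ t) (h1 : t < 1)
    (ht : ∀ A, MeasurableSet A → μ.real (X 0 ⁻¹' A ∩ X 1 ⁻¹' A) = μ.real (X 0 ⁻¹' A) ^ 2 +
      t * μ.real (X 0 ⁻¹' A) * (1 - μ.real (X 0 ⁻¹' A))) (n : ℕ) :
    ∀ A, MeasurableSet A → IsPredictive X μ t n A := by
  induction n using Nat.strong_induction_on with
  | _ n ih =>
    rcases n with _ | n
    · exact fun A _ => isPredictive_zero t A
    -- The rule for `A` also uses the earlier rules for `C` and `D`, so the induction runs over all
    -- measurable sets at once.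
    have hstep : ∀ A C D : Set 𝕏, MeasurableSet A → MeasurableSet C → MeasurableSet D →
        Disjoint C D → 0 < μ.real (X 0 ⁻¹' A) → 0 < μ.real (X 0 ⁻¹' C) →
        0 < μ.real (X 0 ⁻¹' D) → C ∪ D = Aᶜ → IsPredictive X μ t (n + 1) A := by
      intro A C D hA hC hD hCD hqA hqC hqD hU
      have hAC : Disjoint A C := disjoint_compl_right.mono_right (hU ▸ Set.subset_union_left)
      have hAD : Disjoint A D := disjoint_compl_right.mono_right (hU ▸ Set.subset_union_right)
      have hm : ∀ i, MeasurableSet ((![A, C, D] : Fin 3 → Set 𝕏) i) := fun i => by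
        fin_cases i <;> assumption
      refine isPredictive_succ_of_partition (A := ![A, C, D]) hX hexch hsuff h0 h1 hm ?_ ?_ ?_
        (ht A hA) fun k hk i => ih k (by omega) _ (hm i)
      · intro i j hij
        fin_cases i <;> fin_cases j <;>
          first
          | exact absurd rfl hij
          | exact hAC
          | exact hAD
          | exact hCD
          | exact hAC.symm
          | exact hAD.symm
          | exact hCD.symm
      · rw [Set.eq_univ_iff_forall]
        intro x
        by_cases hx : x ∈ A
        · exact Set.mem_iUnion.2 ⟨0, hx⟩
        · have : x ∈ C ∪ D := hU ▸ hx
          rcases this with h | h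
          · exact Set.mem_iUnion.2 ⟨1, h⟩
          · exact Set.mem_iUnion.2 ⟨2, h⟩
      · intro i
        fin_cases i <;> assumption
    intro A hA
    rcases (measureReal_nonneg (μ := μ) (s := X 0 ⁻¹' A)).eq_or_lt with hA0 | hA0
    · exact isPredictive_of_null hX hexch t _ hA hA0.symm
    rcases (measureReal_nonneg (μ := μ) (s := X 0 ⁻¹' Aᶜ)).eq_or_lt with hA1 | hA1
    · simpa using (isPredictive_of_null hX hexch t (n + 1) hA.compl hA1.symm).compl hX hA.compl
    have : IsProbabilityMeasure (μ.map (X 0)) :=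
      Measure.isProbabilityMeasure_map (hX 0).aemeasurable
    have hreal : ∀ {S : Set 𝕏}, MeasurableSet S → (μ.map (X 0)).real S = μ.real (X 0 ⁻¹' S) :=
      fun hS => map_measureReal_apply (hX 0) hS
    obtain ⟨C, D, hC, hD, hCD, hqC, hqD, hU⟩ := exists_split (P := μ.map (X 0)) hB hd
      (fun i => by rw [hreal (hB i)]; exact hpos i) hA
    rw [hreal hC] at hqC
    rw [hreal hD] at hqD
    rcases hU with hU | hU
    · simpa using (hstep Aᶜ C D hA.compl hC hD hCD hA1 hqC hqD (by rw [hU, compl_compl])).compl hX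
        hA.compl
    · exact hstep A C D hA hC hD hCD hA0 hqC hqD hU

theorem iIndepFun_of_isPredictive_zero (hX : ∀ n, Measurable (X n)) (hexch : Exchangeable X μ)
    (h : ∀ n A, MeasurableSet A → IsPredictive X μ 0 n A) : iIndepFun X μ := by
  have key : ∀ (A : ℕ → Set 𝕏), (∀ i, MeasurableSet (A i)) → ∀ n,
      MeasurableSet[pastSigma X n] (⋂ i ∈ Finset.range n, X i ⁻¹' A i) ∧
      μ.real (⋂ i ∈ Finset.range n, X i ⁻¹' A i) = ∏ i ∈ Finset.range n, μ.real (X i ⁻¹' A i) := by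
    intro A hA n
    induction n with
    | zero => simp
    | succ n ih =>
      rw [Finset.range_add_one, Finset.set_biInter_insert, Set.inter_comm,
        Finset.prod_insert Finset.notMem_range_self]
      refine ⟨(pastSigma_mono n.le_succ _ ih.1).inter
        (measurableSet_pastSigma_preimage n.lt_succ_self (hA n)), ?_⟩
      have := h n (A n) (hA n) _ ih.1
      simp only [mul_zero, add_zero, mul_one, sub_zero, one_mul, zero_mul] at this
      rw [this, ih.2, hexch.real_single hX n (hA n)]
  rw [iIndepFun_iff_measure_inter_preimage_eq_mul]
  intro S A hA
  classical
  let A' : ℕ → Set 𝕏 := fun i => if i ∈ S then A i else Set.univ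
  have hA' : ∀ i, MeasurableSet (A' i) := fun i => by
    simp only [A']; split_ifs with hi
    · exact hA i hi
    · exact .univ
  obtain ⟨N, hN⟩ : ∃ N, S ⊆ Finset.range N := S.exists_nat_subset_range
  have h1 := (key A' hA' N).2
  have h2 : ⋂ i ∈ Finset.range N, X i ⁻¹' A' i = ⋂ i ∈ S, X i ⁻¹' A i := by
    ext ω
    simp only [Set.mem_iInter, Set.mem_preimage, A']
    refine ⟨fun h i hi => by simpa [hi] using h i (hN hi), fun h i _ => ?_⟩
    split_ifs with hi
    · exact h i hi
    · trivial
  have h3 : ∏ i ∈ Finset.range N, μ.real (X i ⁻¹' A' i) = ∏ i ∈ S, μ.real (X i ⁻¹' A i) := by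
    rw [← Finset.prod_subset hN fun i _ hi => by simp [A', hi]]
    exact Finset.prod_congr rfl fun i hi => by simp [A', hi]
  rw [h2, h3] at h1
  rw [← ENNReal.toReal_eq_toReal_iff' (measure_ne_top _ _)
    (ENNReal.prod_ne_top fun i _ => measure_ne_top _ _), ENNReal.toReal_prod]
  exact h1

/-- Dividing numerator and denominator of the rule by t turns it into the urn step with total
initial mass α = (1 - t)/t; the division is where t > 0 is needed. -/
theorem real_wordEvent_eq_urnWeight (hX : ∀ n, Measurable (X n)) {t : ℝ} (h0 : 0 < t) (h1 : t < 1)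
    (h : ∀ n A, MeasurableSet A → IsPredictive X μ t n A) {ι : Type*} [Fintype ι] [DecidableEq ι]
    {A : ι → Set 𝕏} (hA : ∀ i, MeasurableSet (A i))
    (hd : Pairwise fun i j => Disjoint (A i) (A j)) (hU : ⋃ i, A i = Set.univ) (l : List ι) :
    μ.real (wordEvent X A l) = urnWeight (fun i => (1 - t) / t * μ.real (X 0 ⁻¹' A i)) l := by
  induction l with
  | nil => simp [wordEvent, urnWeight]
  | cons i l ih =>
    have hm := measurableSet_wordEvent (X := X) hA l
    have h2 := h l.length (A i) (hA i) _ hm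
    have h3 : ∑ j ∈ Finset.range l.length, μ.real (wordEvent X A l ∩ X j ⁻¹' A i) =
        l.count i * μ.real (wordEvent X A l) := by
      rw [← setIntegral_hits hX (hA i), setIntegral_congr_fun (g := fun _ => (l.count i : ℝ))
        (pastSigma_le hX _ _ hm) fun ω hω => by
          simp only [hits_of_mem_wordEvent hd i hω]]
      simp [mul_comm]
    have hsum := sum_real_inter_preimage_of_partition (μ := μ) hX hA hd hU Set.univ 0
    simp only [Set.univ_inter, probReal_univ] at hsum
    have hden := one_add_pred_mul_pos h0.le h1 l.length
    rw [wordEvent, urnWeight, ← ih, ← Finset.mul_sum, hsum]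
    have hden' : (1 - t) / t * 1 + (l.length : ℝ) = (1 + ((l.length : ℝ) - 1) * t) / t := by
      field_simp; ring
    rw [hden', eq_comm, div_mul_eq_mul_div, div_eq_iff (by positivity)]
    rw [h3] at h2
    rw [← mul_div_assoc, h2]
    field_simp

end Johnson

/-! ### The directing measure is a Dirichlet process -/

/-- Taking expectations in the conditional product formula makes word probabilities the mixed
moments of the random cell masses. -/
theorem IsDirectingMeasure.lintegral_list_prod {Ω 𝕏 : Type*} [MeasurableSpace Ω]
    [MeasurableSpace 𝕏] {X : ℕ → Ω → 𝕏} {μ : Measure Ω} [IsProbabilityMeasure μ]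
    {F : Ω → ProbabilityMeasure 𝕏} (h : IsDirectingMeasure F X μ) (hX : ∀ n, Measurable (X n))
    {ι : Type*} {A : ι → Set 𝕏} (hA : ∀ i, MeasurableSet (A i)) (l : List ι) :
    ∫⁻ ω, (l.map fun i => ENNReal.ofReal ((F ω : Measure 𝕏).real (A i))).prod ∂μ =
      ENNReal.ofReal (μ.real (wordEvent X A l)) := by
  obtain ⟨c, hc, hg⟩ := exists_wordEvent_eq_iInter X A l
  have hmeas : MeasurableSet (wordEvent X A l) :=
    pastSigma_le hX _ _ (measurableSet_wordEvent hA l)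
  have hF := h.condIID l.length (fun j => A (c j)) fun j => hA _
  rw [← hc] at hF
  have h1 : ∫ ω, ∏ j, (F ω : Measure 𝕏).real (A (c j)) ∂μ = μ.real (wordEvent X A l) := by
    rw [← integral_congr_ae hF, integral_condExp h.measurable.comap_le,
      integral_indicator_const _ hmeas, smul_eq_mul, mul_one]
  have hint : Integrable (fun ω => ∏ j, (F ω : Measure 𝕏).real (A (c j))) μ :=
    integrable_condExp.congr hF
  rw [← h1, ofReal_integral_eq_lintegral_ofReal hint (Filter.Eventually.of_forall fun ω =>
    Finset.prod_nonneg fun j _ => measureReal_nonneg)]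
  refine lintegral_congr fun ω => ?_
  rw [← hg fun i => (F ω : Measure 𝕏).real (A i)]
  clear hc hg hF h1 hint hmeas c
  induction l with
  | nil => simp
  | cons i l ih =>
    simp only [List.map_cons, List.prod_cons]
    rw [ENNReal.ofReal_mul measureReal_nonneg, ih]

theorem mainTheorem2 {Ω 𝕏 : Type*} [MeasurableSpace Ω] (μ : Measure Ω) [IsProbabilityMeasure μ]
    [TopologicalSpace 𝕏] [PolishSpace 𝕏] [MeasurableSpace 𝕏] [BorelSpace 𝕏]
    (X : ℕ → Ω → 𝕏) (hX : ∀ n, Measurable (X n))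
    (P₀ : Measure 𝕏) (hP₀ : HasLaw (X 0) P₀ μ)
    (hexch : Exchangeable X μ)
    (hsuff : Sufficientness X μ)
    (hsupp : ∀ a b : 𝕏, P₀ {a, b} ≠ 1)
    (hneq : ¬ X 0 =ᵐ[μ] X 1)
    (hindep : ¬ iIndepFun X μ) :
    (∃ F : Ω → ProbabilityMeasure 𝕏, IsDirectingMeasure F X μ) ∧
    ∃ α : ℝ, 0 < α ∧ ∀ F : Ω → ProbabilityMeasure 𝕏, IsDirectingMeasure F X μ →
      IsDirichletProcessLaw α P₀ (μ.map F) := by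
  obtain ⟨ω₀⟩ : Nonempty Ω := nonempty_of_isProbabilityMeasure μ
  have : Nonempty 𝕏 := ⟨X 0 ω₀⟩
  refine ⟨hexch.exists_isDirectingMeasure hX, ?_⟩
  have hPmap : P₀ = μ.map (X 0) := hP₀.map_eq.symm
  have hPprob : IsProbabilityMeasure P₀ :=
    hPmap ▸ Measure.isProbabilityMeasure_map (hX 0).aemeasurable
  have hreal : ∀ {S : Set 𝕏}, MeasurableSet S → P₀.real S = μ.real (X 0 ⁻¹' S) :=
    fun hS => by rw [hPmap, map_measureReal_apply (hX 0) hS]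
  obtain ⟨B, hB, hBd, hBpos⟩ := exists_three_disjoint_pos hsupp
  have hBpos' : ∀ i, 0 < μ.real (X 0 ⁻¹' B i) := fun i => hreal (hB i) ▸ hBpos i
  have h01 : Disjoint (B 0) (B 1) := hBd (by decide)
  obtain ⟨t, ht⟩ := exists_correlation hX hexch hsuff (hB 0) (hB 1) h01 (hBpos' 0) (hBpos' 1)
  have hB0 : μ.real (X 0 ⁻¹' B 0) < 1 := by
    have h1 := measureReal_union (μ := μ) (h01.preimage (X 0)) (hX 0 (hB 1))
    have h2 : μ.real (X 0 ⁻¹' B 0 ∪ X 0 ⁻¹' B 1) ≤ 1 := measureReal_le_one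
    linarith [hBpos' 1]
  have ht0 := correlation_nonneg hX hexch (hB 0) (hBpos' 0) hB0 (ht _ (hB 0))
  have ht1 := correlation_lt_one hX hneq ht
  have hpred := isPredictive_of_sufficientness hX hexch hsuff hB hBd hBpos' ht0 ht1 ht
  have htpos : 0 < t := by
    rcases ht0.eq_or_lt with rfl | h
    · exact absurd (iIndepFun_of_isPredictive_zero hX hexch hpred) hindep
    · exact h
  have hα : 0 < (1 - t) / t := div_pos (by linarith) htpos
  -- The constant comes from the law of the sequence alone, so it serves every directing measure at
  -- once.
  refine ⟨(1 - t) / t, hα, fun F hF k A hA hd hU => ?_⟩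
  have hsum := sum_real_inter_preimage_of_partition (μ := μ) hX hA hd hU Set.univ 0
  simp only [Set.univ_inter, probReal_univ] at hsum
  have hpar : (fun i => (1 - t) / t * P₀.real (A i)) =
      fun i => (1 - t) / t * μ.real (X 0 ⁻¹' A i) := by
    ext i; rw [hreal (hA i)]
  have hnn : ∀ i, 0 ≤ (1 - t) / t * μ.real (X 0 ⁻¹' A i) := fun i => by positivity
  have hpos : 0 < ∑ i, (1 - t) / t * μ.real (X 0 ⁻¹' A i) := by
    rw [← Finset.mul_sum, hsum, mul_one]; exact hα
  have hev : Measurable fun (P : ProbabilityMeasure 𝕏) (i : Fin k) => (P : Measure 𝕏).real (A i) :=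
    measurable_pi_lambda _ fun i =>
      ((Measure.measurable_coe (hA i)).comp measurable_subtype_coe).ennreal_toReal
  rw [hpar, Measure.map_map hev hF.measurable]
  have hm := hev.comp hF.measurable
  have := Measure.isProbabilityMeasure_map (μ := μ) hm.aemeasurable
  have := isProbabilityMeasure_dirichletDist hnn
  refine measure_ext_of_moments ?_ (dirichletDist_ae_mem_Icc hnn hpos) fun l => ?_
  · rw [ae_map_iff hm.aemeasurable (by measurability)]
    exact Filter.Eventually.of_forall fun ω i => ⟨measureReal_nonneg, measureReal_le_one⟩
  · rw [lintegral_list_prod_dirichletDist hnn hpos, ← real_wordEvent_eq_urnWeight hX htpos ht1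
      hpred hA hd hU, ← hF.lintegral_list_prod hX hA,
      lintegral_map (measurable_list_prod_ofReal l) hm]
    rfl
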